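/- Consider a Markov decision process with finite sets of states $\mathcal S$, actions $\mathcal A$ and rewards $\mathcal R\subset\mathbb R$, transition law $P$, reward law $R$, initial law $d_0$ and discount $\gamma\in[0,1]$. Let an acyclic network of $m$ coagents, topologically ordered, with parameters $\theta=(\theta_1,\dots,\theta_m)$, $\theta_i\in\mathbb R^{n_i}$ (not shared), act in it: at time $t$, in state $S_t$, coagent $i$ sees the local state $X^i_t$ consisting of $S_t$ and the outputs of the preceding coagents (parts of which it may ignore), and draws an output $U^i_t$ from an output set $\mathcal U^i$ with probability (or probability density with respect to a fixed $\sigma$-finite measure) $\pi_i(X^i_t,\cdot,\theta_i)$; the action $A_t$ is a function of $S_t$ and of all outputs. Each $\pi_i(x,u,\cdot)$ is differentiable, and the joint density of the outputs in each state, $\prod_i\pi_i$, is differentiable in $\theta$ also as a map into $L^1$, with the pointwise derivative (automatic if the sets $\mathcal U^i$ are finite). Put $G_t=\sum_{k\ge0}\gamma^kR_{t+k}$, and let $$J(\theta)=\mathbf E[G_0\mid\theta],\qquad \Delta_i(\theta)=\mathbf E\Big[\sum_{t=0}^\infty\gamma^tG_t\,\frac{\partial\ln\pi_i(X^i_t,U^i_t,\theta_i)}{\partial\theta_i}\,\Big|\,\theta\Big]$$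 be the objective and the local policy gradient of coagent $i$. Returns are finite in the following sense: $\gamma<1$; or $\gamma=1$, $J$ is bounded above over all $\theta$, and there is a set of terminal states that is never left and carries only zero rewards, and that is reached almost surely from every state under every $\theta$. Let $\alpha_t>0$ be deterministic step sizes with $\sum_t\alpha_t=\infty$ and $\sum_t\alpha_t^2<\infty$. Let $\theta^{(t)}$ be random parameters adapted to a filtration $(\mathcal F_t)$ such that every coagent updates $$\theta^{(t+1)}_i=\theta^{(t)}_i+\alpha_t\widehat\Delta_{i,t},$$ where $\widehat\Delta_{i,t}$ is integrable with $\mathbf E[\widehat\Delta_{i,t}\mid\mathcal F_t]=\Delta_i(\theta^{(t)})$ almost surely. Assume the technical conditions: $\nabla J$ is Lipschitz continuous, and for some constant $C$, for all $t$, almost surely, $$\mathbf E\Big[\sum_i\|\widehat\Delta_{i,t}-\Delta_i(\theta^{(t)})\|^2\,\Big|\,\mathcal F_t\Big]\le C\,\big(1+\|\nabla J(\theta^{(t)})\|^2\big).$$ Then $J$ is differentiable, and almost surely $J(\theta^{(t)})$ converges to a finite value and $\nabla J(\theta^{(t)})\to0$ as $t\to\infty$. -/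

import Mathlib

open MeasureTheory ProbabilityTheory Filter Topology
open scoped ENNReal NNReal

noncomputable section

/-- A Markov decision process with state set `S`, action set `A` and a finite set of rewards.
`P s a` is the law of the next state, `R s a s'` the law of the reward. -/
structure MDP (S A : Type*) where
  rewards : Finset ℝ
  P : S → A → PMF S
  R : S → A → S → PMF rewards
  d₀ : PMF S
  γ : ℝ
  γ_nonneg : 0 ≤ γ
  γ_le_one : γ ≤ 1

/-- The local state of the `i`-th coagent: the state of the environment, and the outputs of the
coagents that precede `i` in a topological order of the (acyclic) network. -/
abbrev LocalState (S : Type*) {m : ℕ} (U : Fin m → Type*) (i : Fin m) : Type _ :=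
  S × ((j : {j : Fin m // j < i}) → U j)

/-- The parameter vectors `θ = (θ₁, …, θ_m)` with `θ_i ∈ ℝ^(n i)`, with the Euclidean norm. -/
abbrev Params {m : ℕ} (n : Fin m → ℕ) : Type :=
  PiLp 2 (fun i : Fin m => EuclideanSpace ℝ (Fin (n i)))

/-- An acyclic network of `m` coagents that share no parameters. The `i`-th coagent has an arbitrary
(discrete or continuous) output set `U i` with a reference measure `ν i` (counting measure in the
discrete case); `policy i x u ϑ` is the probability density (the probability, in the
discrete case) of the output `u` in the local state `x` under the parameters `ϑ` of this coagent.
A coagent may ignore parts of its local state. Any randomness that is not parameterized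
(noisy observations, for instance) is a coagent with `n i = 0`. The action is read
off from the state and the outputs of the coagents; it may be just the output of one of them. -/
structure CoagentNetwork (S A : Type*) [MeasurableSpace S] [MeasurableSpace A] {m : ℕ}
    (U : Fin m → Type*) [∀ i, MeasurableSpace (U i)] (n : Fin m → ℕ) where
  ν : ∀ i, Measure (U i)
  sigmaFinite : ∀ i, SigmaFinite (ν i)
  policy : ∀ i, LocalState S U i → U i → EuclideanSpace ℝ (Fin (n i)) → ℝ
  policy_nonneg : ∀ i x u ϑ, 0 ≤ policy i x u ϑ
  policy_measurable : ∀ i ϑ, Measurable fun p : LocalState S U i × U i => policy i p.1 p.2 ϑ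
  policy_lintegral : ∀ i x ϑ, ∫⁻ u, ENNReal.ofReal (policy i x u ϑ) ∂(ν i) = 1
  policy_differentiable : ∀ i x u, Differentiable ℝ (policy i x u)
  action : S → (∀ i, U i) → A
  action_measurable : ∀ s, Measurable (action s)

namespace CoagentNetwork

variable {S A : Type*} [MeasurableSpace S] [MeasurableSpace A] {m : ℕ}
  {U : Fin m → Type*} [∀ i, MeasurableSpace (U i)] {n : Fin m → ℕ}

instance (N : CoagentNetwork S A U n) (i : Fin m) : SigmaFinite (N.ν i) := N.sigmaFinite i

/-- The local state of coagent `i` when the state is `s` and the outputs are `u`. -/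
def localState (s : S) (u : ∀ i, U i) (i : Fin m) : LocalState S U i := (s, fun j => u j)

/-- The joint density of the outputs of all coagents in state `s`, with respect to the product
of the reference measures. -/
def jointDensity (N : CoagentNetwork S A U n) (s : S) (u : ∀ i, U i) (θ : Params n) : ℝ :=
  ∏ i, N.policy i (localState s u i) (u i) (θ i)

/-- Differentiability in mean of the joint density: in every state and at every parameter, the error
of the first-order expansion in `θ` is `o(‖θ' - θ‖)` in the `L¹`-norm over the outputs. This is
what differentiability of the policy means for continuous outputs; it is automatic if all output
sets are finite. -/
def DifferentiableInMean (N : CoagentNetwork S A U n) : Prop :=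
  ∀ (s : S) (θ : Params n), ∀ ε > (0 : ℝ), ∀ᶠ θ' in 𝓝 θ,
    ∫⁻ u, ‖N.jointDensity s u θ' - N.jointDensity s u θ
        - fderiv ℝ (N.jointDensity s u) θ (θ' - θ)‖ₑ ∂(Measure.pi N.ν)
      ≤ ENNReal.ofReal (ε * ‖θ' - θ‖)

/-- For finite output sets, differentiability in mean is automatic. -/
lemma differentiableInMean_of_finite [∀ i, Finite (U i)] (N : CoagentNetwork S A U n) :
    N.DifferentiableInMean := by
  intro s θ ε hε
  set ρ := Measure.pi N.ν with hρ
  have hfin : ρ Set.univ < ∞ := by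
    have hsub : (Set.univ : Set (∀ i, U i)) ⊆
        ⋃ u : (∀ i, U i), spanningSets ρ (spanningSetsIndex ρ u) :=
      fun u _ => Set.mem_iUnion.2 ⟨u, mem_spanningSetsIndex ρ u⟩
    refine (measure_mono hsub).trans_lt ?_
    have : Fintype (∀ i, U i) := Fintype.ofFinite _
    refine (measure_iUnion_fintype_le _ _).trans_lt ?_
    exact ENNReal.sum_lt_top.2 fun u _ => measure_spanningSets_lt_top ρ _
  set c : ℝ := (ρ Set.univ).toReal with hc
  have hc0 : 0 ≤ c := ENNReal.toReal_nonneg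
  have hdiff : ∀ u, Differentiable ℝ (N.jointDensity s u) := by
    intro u
    unfold jointDensity
    have h : ∀ i, Differentiable ℝ fun ϑ : Params n =>
        N.policy i (localState s u i) (u i) (ϑ i) := fun i =>
      (N.policy_differentiable i _ _).comp
        (PiLp.proj (𝕜 := ℝ) 2 (fun i : Fin m => EuclideanSpace ℝ (Fin (n i))) i).differentiable
    fun_prop
  have hev : ∀ᶠ θ' in 𝓝 θ, ∀ u, ‖N.jointDensity s u θ' - N.jointDensity s u θ
        - fderiv ℝ (N.jointDensity s u) θ (θ' - θ)‖ ≤ ε / (c + 1) * ‖θ' - θ‖ :=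
    eventually_all.2 fun u =>
      ((hdiff u θ).hasFDerivAt.isLittleO.def (by positivity))
  filter_upwards [hev] with θ' h
  calc ∫⁻ u, ‖N.jointDensity s u θ' - N.jointDensity s u θ
        - fderiv ℝ (N.jointDensity s u) θ (θ' - θ)‖ₑ ∂ρ
      ≤ ∫⁻ _, ENNReal.ofReal (ε / (c + 1) * ‖θ' - θ‖) ∂ρ := by
        refine lintegral_mono fun u => ?_
        rw [← ofReal_norm]
        exact ENNReal.ofReal_le_ofReal (h u)
    _ = ENNReal.ofReal (ε / (c + 1) * ‖θ' - θ‖ * c) := by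
        rw [lintegral_const, ENNReal.ofReal_mul (by positivity) (q := c), hc,
          ENNReal.ofReal_toReal hfin.ne]
    _ ≤ ENNReal.ofReal (ε * ‖θ' - θ‖) := by
        refine ENNReal.ofReal_le_ofReal ?_
        have h1 : ε / (c + 1) * c ≤ ε := by
          rw [div_mul_eq_mul_div, div_le_iff₀ (by positivity)]
          nlinarith
        nlinarith [norm_nonneg (θ' - θ)]

/-- The law of the outputs of all coagents in state `s`. -/
def outputMeasure (N : CoagentNetwork S A U n) (θ : Params n) (s : S) : Measure (∀ i, U i) :=
  (Measure.pi N.ν).withDensity fun u => ENNReal.ofReal (N.jointDensity s u θ)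

lemma measurable_policy_comp (N : CoagentNetwork S A U n) (θ : Params n) (s : S) (i : Fin m) :
    Measurable fun u : (∀ i, U i) =>
      ENNReal.ofReal (N.policy i (localState s u i) (u i) (θ i)) := by
  have h : Measurable fun u : (∀ i, U i) => (localState s u i, u i) := by
    unfold localState
    fun_prop
  exact ENNReal.measurable_ofReal.comp ((N.policy_measurable i (θ i)).comp h)

/-- The joint density has total mass one. -/
lemma lintegral_jointDensity (N : CoagentNetwork S A U n) (θ : Params n) (s : S) :
    ∫⁻ u, ENNReal.ofReal (N.jointDensity s u θ) ∂(Measure.pi N.ν) = 1 := by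
  classical
  set f : Fin m → (∀ i, U i) → ℝ≥0∞ := fun i u =>
    ENNReal.ofReal (N.policy i (localState s u i) (u i) (θ i)) with hf
  have hfm : ∀ i, Measurable (f i) := fun i => N.measurable_policy_comp θ s i
  have key : ∀ k : ℕ, k ≤ m → ∀ x : (∀ i, U i),
      lmarginal N.ν (Finset.univ.filter fun i : Fin m => (i : ℕ) < k)
        (fun u => ∏ i ∈ Finset.univ.filter (fun i : Fin m => (i : ℕ) < k), f i u) x = 1 := by
    intro k
    induction k with
    | zero => intro _ x; simp
    | succ k ih =>
      intro hk x
      have hins : (Finset.univ.filter fun i : Fin m => (i : ℕ) < k + 1)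
          = insert (⟨k, hk⟩ : Fin m) (Finset.univ.filter fun i : Fin m => (i : ℕ) < k) := by
        ext i
        simp only [Finset.mem_filter, Finset.mem_univ, true_and, Finset.mem_insert, Fin.ext_iff]
        omega
      have hnot : (⟨k, hk⟩ : Fin m) ∉ (Finset.univ.filter fun i : Fin m => (i : ℕ) < k) := by
        simp
      rw [hins, lmarginal_insert' _ (Finset.measurable_prod _ fun i _ => hfm i) hnot]
      rw [← ih (by omega) x]
      congr 1
      ext u
      simp_rw [Finset.prod_insert hnot]
      have h1 : ∀ y : U ⟨k, hk⟩, ∏ i ∈ Finset.univ.filter (fun i : Fin m => (i : ℕ) < k),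
          f i (Function.update u ⟨k, hk⟩ y)
          = ∏ i ∈ Finset.univ.filter (fun i : Fin m => (i : ℕ) < k), f i u := by
        intro y
        refine Finset.prod_congr rfl fun i hi => ?_
        have hik : (i : ℕ) < k := by simpa using hi
        have hloc : localState s (Function.update u ⟨k, hk⟩ y) i = localState s u i := by
          unfold localState
          refine Prod.ext rfl (funext fun j => ?_)
          have hj : ((j : Fin m) : ℕ) < i := j.2
          exact Function.update_of_ne (by intro h; rw [h] at hj; simp at hj; omega) _ _
        have hi' : Function.update u ⟨k, hk⟩ y i = u i :=
          Function.update_of_ne (by intro h; rw [h] at hik; simp at hik) _ _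
        simp only [hf, hloc, hi']
      have h2 : ∀ y : U ⟨k, hk⟩, f ⟨k, hk⟩ (Function.update u ⟨k, hk⟩ y)
          = ENNReal.ofReal (N.policy ⟨k, hk⟩ (localState s u ⟨k, hk⟩) y (θ ⟨k, hk⟩)) := by
        intro y
        have hloc : localState s (Function.update u ⟨k, hk⟩ y) ⟨k, hk⟩
            = localState s u ⟨k, hk⟩ := by
          unfold localState
          refine Prod.ext rfl (funext fun j => ?_)
          exact Function.update_of_ne (ne_of_lt j.2) _ _
        simp only [hf, hloc, Function.update_self]
      simp_rw [h1, h2]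
      rw [lintegral_mul_const', N.policy_lintegral, one_mul]
      exact ENNReal.prod_ne_top fun i _ => ENNReal.ofReal_ne_top
  have hden : ∀ u, ENNReal.ofReal (N.jointDensity s u θ) = ∏ i, f i u := fun u =>
    ENNReal.ofReal_prod_of_nonneg fun i _ => N.policy_nonneg _ _ _ _
  simp_rw [hden]
  by_cases hU : Nonempty (∀ i, U i)
  · obtain ⟨x⟩ := hU
    have hall : (Finset.univ.filter fun i : Fin m => (i : ℕ) < m) = Finset.univ := by
      ext i; simp
    have := key m le_rfl x
    rw [hall] at this
    rwa [lintegral_eq_lmarginal_univ x]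
  · exfalso
    -- an empty output set would contradict the normalization of the first such coagent
    have hne : ∀ k : ℕ, ∀ i : Fin m, (i : ℕ) = k → Nonempty (U i) := by
      intro k
      induction k using Nat.strong_induction_on with
      | _ k ih =>
        intro i hi
        by_contra hemp
        rw [not_nonempty_iff] at hemp
        have x : LocalState S U i :=
          (s, fun j => (ih (j : Fin m) (hi ▸ j.2) (j : Fin m) rfl).some)
        have := N.policy_lintegral i x (θ i)
        simp [Measure.eq_zero_of_isEmpty] at this
    exact hU ⟨fun i => (hne i i rfl).some⟩

variable [Finite S] [MeasurableSingletonClass S]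

/-- The outputs of all coagents, given the state. -/
def outputKernel (N : CoagentNetwork S A U n) (θ : Params n) : Kernel S (∀ i, U i) :=
  Kernel.ofFunOfCountable (N.outputMeasure θ)

instance (N : CoagentNetwork S A U n) (θ : Params n) : IsMarkovKernel (N.outputKernel θ) := by
  refine ⟨fun s => ⟨?_⟩⟩
  change N.outputMeasure θ s Set.univ = 1
  rw [outputMeasure, withDensity_apply _ MeasurableSet.univ, Measure.restrict_univ]
  exact N.lintegral_jointDensity θ s

end CoagentNetwork

section Run

variable {S A : Type*} [MeasurableSpace S] [MeasurableSpace A] {m : ℕ}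
  {U : Fin m → Type*} [∀ i, MeasurableSpace (U i)] {n : Fin m → ℕ}
  [Finite S] [MeasurableSingletonClass S]

lemma measurable_action_uncurry (N : CoagentNetwork S A U n) :
    Measurable fun p : S × (∀ i, U i) => (p.1, N.action p.1 p.2) :=
  measurable_fst.prodMk (measurable_from_prod_countable_right fun s => N.action_measurable s)

variable [Finite A] [MeasurableSingletonClass A]

/-- The next state and the reward, given the state and the action. -/
def envKernel (M : MDP S A) : Kernel (S × A) (S × M.rewards) :=
  Kernel.ofFunOfCountable fun p =>
    ((M.P p.1 p.2).bind fun s' => (M.R p.1 p.2 s').map fun r => (s', r)).toMeasure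

instance (M : MDP S A) : IsMarkovKernel (envKernel M) :=
  ⟨fun p => PMF.toMeasure.isProbabilityMeasure
    ((M.P p.1 p.2).bind fun s' => (M.R p.1 p.2 s').map fun r => (s', r))⟩

/-- What happens in one time step `t`: `(S_t, ((U¹_t, …, U^m_t), (S_{t+1}, R_t)))`. -/
abbrev StepRecord (M : MDP S A) (U : Fin m → Type*) : Type _ :=
  S × ((∀ i, U i) × (S × M.rewards))

/-- One time step, started in a given state: the coagents produce their outputs, the action
is read off, and the environment produces the next state and the reward. -/
def stepKernel (M : MDP S A) (N : CoagentNetwork S A U n) (θ : Params n) :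
    Kernel S (StepRecord M U) :=
  Kernel.id ×ₖ
    (N.outputKernel θ ⊗ₖ (envKernel M).comap _ (measurable_action_uncurry N))

instance (M : MDP S A) (N : CoagentNetwork S A U n) (θ : Params n) :
    IsMarkovKernel (stepKernel M N θ) := by
  unfold stepKernel; infer_instance

/-- The law of an episode under the fixed parameters `θ`, when `S₀` has the law `d`. -/
def episode (M : MDP S A) (N : CoagentNetwork S A U n) (θ : Params n) (d : PMF S) :
    Measure (ℕ → StepRecord M U) :=
  Kernel.trajMeasure (X := fun _ => StepRecord M U)
    ((stepKernel M N θ) ∘ₘ d.toMeasure)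
    fun t => (stepKernel M N θ).comap
      (fun h : (i : Finset.Iic t) → StepRecord M U => (h ⟨t, by simp⟩).2.2.1) (by fun_prop)

/-- `S_t` -/
def stateAt {M : MDP S A} (ω : ℕ → StepRecord M U) (t : ℕ) : S := (ω t).1

/-- `(U¹_t, …, U^m_t)` -/
def outputsAt {M : MDP S A} (ω : ℕ → StepRecord M U) (t : ℕ) : ∀ i, U i := (ω t).2.1

/-- `R_t` -/
def rewardAt {M : MDP S A} (ω : ℕ → StepRecord M U) (t : ℕ) : ℝ := (ω t).2.2.2

/-- `G_t = ∑_k γ^k R_{t+k}` -/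
def discountedReturn {M : MDP S A} (ω : ℕ → StepRecord M U) (t : ℕ) : ℝ :=
  ∑' k, M.γ ^ k * rewardAt ω (t + k)

/-- The objective `J(θ) = E[∑_t γ^t R_t | θ]`. -/
def objective (M : MDP S A) (N : CoagentNetwork S A U n) (θ : Params n) : ℝ :=
  ∫ ω, discountedReturn ω 0 ∂(episode M N θ M.d₀)

/-- The local policy gradient
`Δ_i = E[∑_t γ^t G_t ∂ ln π_i(X_t, U_t, θ_i) / ∂θ_i | θ]` of the `i`-th coagent. -/
def localPolicyGradient (M : MDP S A) (N : CoagentNetwork S A U n) (i : Fin m) (θ : Params n) :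
    EuclideanSpace ℝ (Fin (n i)) :=
  ∫ ω, ∑' t, (M.γ ^ t * discountedReturn ω t) •
      gradient (fun ϑ => Real.log (N.policy i
        (CoagentNetwork.localState (stateAt ω t) (outputsAt ω t) i) (outputsAt ω t i) ϑ)) (θ i)
    ∂(episode M N θ M.d₀)

/-- The task is episodic: there is a set of terminal states, which is never left and where all
rewards are zero, and from every state and under all parameters an episode reaches it almost
surely. -/
def IsEpisodic (M : MDP S A) (N : CoagentNetwork S A U n) : Prop :=
  ∃ Z : Set S,
    (∀ s ∈ Z, ∀ a s', M.P s a s' ≠ 0 → s' ∈ Z ∧ ∀ r, M.R s a s' r ≠ 0 → (r : ℝ) = 0) ∧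
    ∀ (θ : Params n) (s : S), ∀ᵐ ω ∂(episode M N θ (PMF.pure s)), ∃ t, stateAt ω t ∈ Z

/-- Discounted sums of rewards are finite: automatic for `γ < 1`, as there are finitely many
rewards; for `γ = 1` it means that the task is episodic and that the expected returns
are bounded above over all parameters. -/
def HasFiniteReturns (M : MDP S A) (N : CoagentNetwork S A U n) : Prop :=
  M.γ < 1 ∨ (IsEpisodic M N ∧ BddAbove (Set.range (objective M N)))

end Run

end

/-!
The proof combines a policy gradient theorem with a convergence theorem for stochastic gradient ascent.

*Policy gradient* (`gradient_objective`). An episode is a chain of step records: each record is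
drawn from a kernel that depends on the state alone, and it carries the next state. With finitely
many states, the value function `v` solves the Poisson equation `v = r + γ Q v`, where `Q` is the
transition operator killed in the terminal states; for a discount factor below one, nothing is
killed. In both cases the discounted probabilities of not having been absorbed are summable
(`IsSummablyAbsorbed`; for episodic tasks they decay geometrically, see
`isSummablyAbsorbed_of_ae_reaches`), so `1 - γ Q` is invertible. Differentiability in mean of the joint
density makes the entries of `r` and `Q` differentiable (`hasFDerivAt_integral_mul_jointDensity`),
hence `v = (1 - γ Q)⁻¹ r` is differentiable. Differentiating the Poisson equation in the parameters
of one coagent shows that the derivative of `v` is the sum over `t` of the discounted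
expectations of `score * (reward + γ v(next))` at time `t` (`fderiv_potential_apply`). By the
Markov property and Fubini's theorem, the expectation of `∑ γ^t G_t score_t` is the same sum
(`inner_integral_tsum_return_smul`). The score is only integrable, and returns are unbounded
when `γ = 1`; summability comes from an envelope that vanishes in the terminal states.

*Stochastic ascent* (`ae_tendsto_of_stochastic_gradient_ascent`). Let `f` be bounded above with a
Lipschitz gradient. The first-order lower bound for `f` and the inequality `‖∇f‖² ≤ 4 L (sup f - f)`
turn the noise condition into a Gronwall recursion for the expected gaps, which gives
`∑ α E‖∇f‖² < ∞` and `∑ α² E‖D‖² < ∞`. The values then converge by the supermartingale convergence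
theorem, the accumulated noise converges as a square integrable martingale, and pathwise these two
facts force `∇f → 0` (`tendsto_zero_of_summable_mul_sq`). As the initial value need not be integrable,
everything is done under the restriction of the probability measure to events in the initial σ-algebra
on which it is.
-/

/-! ### Gradient ascent along a fixed sequence of errors -/

section Deterministic

/-- Robbins-Monro iterates along a Lipschitz field `g` whose weighted squared norms are summable and
whose accumulated errors converge satisfy `g (x t) → 0`: after the last time that `‖g (x t)‖` was
below `ε`, the iterates move by only a small amount, because there
`‖g‖ ≤ ‖g‖² / ε`. -/
lemma tendsto_zero_of_summable_mul_sq {E : Type*} [NormedAddCommGroup E] [NormedSpace ℝ E]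
    {g : E → E} {L : ℝ≥0} (hg : LipschitzWith L g) {x w : ℕ → E} {α : ℕ → ℝ}
    (hα_pos : ∀ t, 0 < α t)
    (hα_sum : Tendsto (fun T => ∑ t ∈ Finset.range T, α t) atTop atTop)
    (hα_zero : Tendsto α atTop (𝓝 0))
    (hx : ∀ t, x (t + 1) = x t + α t • (g (x t) + w t))
    (hs : Summable fun t => α t * ‖g (x t)‖ ^ 2)
    {W : E} (hw : Tendsto (fun T => ∑ t ∈ Finset.range T, α t • w t) atTop (𝓝 W)) :
    Tendsto (fun t => g (x t)) atTop (𝓝 0) := by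
  have key : ∀ ε > 0, ∃ N, ∀ t ≥ N, ‖g (x t)‖ < 2 * ε := by
    intro ε hε
    set η : ℝ := ε / (3 * (L + 1)) with hη
    have hη0 : 0 < η := by positivity
    obtain ⟨N₁, hN₁⟩ := Metric.cauchySeq_iff.1 hw.cauchySeq η hη0
    obtain ⟨N₂, hN₂⟩ := Metric.cauchySeq_iff.1 hs.hasSum.tendsto_sum_nat.cauchySeq
      (η * ε) (by positivity)
    obtain ⟨N₃, hN₃⟩ := eventually_atTop.1
      (hα_zero.eventually (gt_mem_nhds (show 0 < η / ε by positivity)))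
    set N := max N₁ (max N₂ N₃)
    have hfreq : ∃ n ≥ N, ‖g (x n)‖ < ε := by
      by_contra! hcon
      have hsum : Summable α := by
        rw [← summable_nat_add_iff N]
        refine Summable.of_nonneg_of_le (fun t => (hα_pos _).le) (fun t => ?_)
          (((summable_nat_add_iff N).2 hs).mul_left (1 / ε ^ 2))
        have h1 : ε ^ 2 ≤ ‖g (x (t + N))‖ ^ 2 := by
          have := hcon (t + N) (by omega)
          gcongr
        have h2 := mul_le_mul_of_nonneg_left h1 (hα_pos (t + N)).le
        rw [div_mul_eq_mul_div, one_mul, le_div_iff₀ (by positivity)]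
        exact h2
      exact not_tendsto_nhds_of_tendsto_atTop hα_sum _ hsum.hasSum.tendsto_sum_nat
    obtain ⟨n, hn, hgn⟩ := hfreq
    have hlast : ∀ t ≥ n, ∃ s, n ≤ s ∧ s ≤ t ∧ ‖g (x s)‖ < ε ∧
        ∀ r, s < r → r ≤ t → ε ≤ ‖g (x r)‖ := by
      intro t ht
      induction t, ht using Nat.le_induction with
      | base => exact ⟨n, le_rfl, le_rfl, hgn, fun r h1 h2 => absurd h1 (by omega)⟩
      | succ t ht ih =>
        obtain ⟨s, hs1, hs2, hs3, hs4⟩ := ih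
        by_cases h : ‖g (x (t + 1))‖ < ε
        · exact ⟨t + 1, by omega, le_rfl, h, fun r h1 h2 => absurd h1 (by omega)⟩
        · refine ⟨s, hs1, by omega, hs3, fun r h1 h2 => ?_⟩
          rcases Nat.lt_or_ge t r with h3 | h3
          · have : r = t + 1 := by omega
            subst this
            exact not_lt.1 h
          · exact hs4 r h1 h3
    refine ⟨n, fun t ht => ?_⟩
    obtain ⟨s, hs1, hs2, hs3, hs4⟩ := hlast t ht
    have hsN₁ : N₁ ≤ s := le_trans (le_max_left _ _) (hn.trans hs1)
    have hsN₂ : N₂ ≤ s :=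
      le_trans ((le_max_left _ _).trans (le_max_right _ _)) (hn.trans hs1)
    have hsN₃ : N₃ ≤ s :=
      le_trans ((le_max_right _ _).trans (le_max_right _ _)) (hn.trans hs1)
    have hdiff : x t - x s
        = ∑ r ∈ Finset.Ico s t, α r • g (x r) + ∑ r ∈ Finset.Ico s t, α r • w r := by
      rw [← Finset.sum_add_distrib, ← Finset.sum_Ico_sub x hs2]
      refine Finset.sum_congr rfl fun r _ => ?_
      rw [hx r, smul_add]
      abel
    have hW : ‖∑ r ∈ Finset.Ico s t, α r • w r‖ < η := by
      have := hN₁ t (hsN₁.trans hs2) s hsN₁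
      rwa [dist_eq_norm, ← Finset.sum_Ico_eq_sub _ hs2] at this
    have hS : ∑ r ∈ Finset.Ico s t, α r * ‖g (x r)‖ ^ 2 < η * ε := by
      have := hN₂ t (hsN₂.trans hs2) s hsN₂
      rw [dist_eq_norm, ← Finset.sum_Ico_eq_sub _ hs2] at this
      exact (le_abs_self _).trans_lt this
    have hG : ‖∑ r ∈ Finset.Ico s t, α r • g (x r)‖ ≤ η + η := by
      calc ‖∑ r ∈ Finset.Ico s t, α r • g (x r)‖
          ≤ ∑ r ∈ Finset.Ico s t, ((if r = s then α s * ε else 0)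
              + α r * ‖g (x r)‖ ^ 2 / ε) := by
            refine norm_sum_le_of_le _ fun r hr => ?_
            rw [norm_smul, Real.norm_of_nonneg (hα_pos r).le]
            have hnn : 0 ≤ α r * ‖g (x r)‖ ^ 2 / ε := by
              have := hα_pos r
              positivity
            split_ifs with h
            · subst h
              have := mul_le_mul_of_nonneg_left hs3.le (hα_pos r).le
              linarith
            · rw [Finset.mem_Ico] at hr
              have := hs4 r (by omega) (by omega)
              rw [zero_add, le_div_iff₀ hε, sq, mul_assoc]
              have := hα_pos r
              gcongr
        _ ≤ α s * ε + (∑ r ∈ Finset.Ico s t, α r * ‖g (x r)‖ ^ 2) / ε := by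
            rw [Finset.sum_add_distrib, Finset.sum_div]
            gcongr
            rw [Finset.sum_ite_eq']
            have := hα_pos s
            split_ifs
            · exact le_rfl
            · positivity
        _ ≤ η + η := by
            have h1 : α s < η / ε := hN₃ s hsN₃
            rw [lt_div_iff₀ hε] at h1
            have h2 := (div_lt_iff₀ hε).2 hS
            linarith
    have hx3 : ‖x t - x s‖ ≤ 3 * η := by
      rw [hdiff]
      linarith [norm_add_le (∑ r ∈ Finset.Ico s t, α r • g (x r))
        (∑ r ∈ Finset.Ico s t, α r • w r)]
    have hL : ‖g (x t) - g (x s)‖ ≤ ε := by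
      calc ‖g (x t) - g (x s)‖ ≤ L * ‖x t - x s‖ := by
            simpa [dist_eq_norm] using hg.dist_le_mul (x t) (x s)
        _ ≤ (L + 1) * (3 * η) := by gcongr; linarith
        _ = ε := by rw [hη]; field_simp
    have := norm_le_insert' (g (x t)) (g (x s))
    linarith
  rw [Metric.tendsto_atTop]
  intro ε hε
  obtain ⟨N, hN⟩ := key (ε / 2) (by positivity)
  refine ⟨N, fun t ht => ?_⟩
  rw [dist_zero_right]
  linarith [hN t ht]

end Deterministic

section Descent

variable {E : Type*} [NormedAddCommGroup E] [InnerProductSpace ℝ E] [CompleteSpace E]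

/-- A first-order lower bound for a function with Lipschitz gradient. -/
lemma LipschitzWith.add_inner_gradient_sub_le {f : E → ℝ} (hf : Differentiable ℝ f) {L : ℝ≥0}
    (hL : LipschitzWith L (gradient f)) (x y : E) :
    f x + inner ℝ (gradient f x) (y - x) - L * ‖y - x‖ ^ 2 ≤ f y := by
  have h := (convex_segment x y).norm_image_sub_le_of_norm_fderiv_le' (𝕜 := ℝ) (f := f)
    (φ := fderiv ℝ f x) (C := L * ‖y - x‖) (fun z _ => hf z) (fun z hz => ?_)
    (left_mem_segment ℝ x y) (right_mem_segment ℝ x y)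
  · have h2 : fderiv ℝ f x (y - x) = inner ℝ (gradient f x) (y - x) := by
      rw [gradient, InnerProductSpace.toDual_symm_apply]
    rw [h2, Real.norm_eq_abs] at h
    have := neg_abs_le (f y - f x - inner ℝ (gradient f x) (y - x))
    nlinarith
  · have h1 : ‖fderiv ℝ f z - fderiv ℝ f x‖ = ‖gradient f z - gradient f x‖ := by
      rw [gradient, gradient, ← map_sub, LinearIsometryEquiv.norm_map]
    rw [h1]
    have h2 := hL.dist_le_mul z x
    rw [dist_eq_norm, dist_eq_norm] at h2
    refine h2.trans ?_
    gcongr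
    obtain ⟨c, hc, rfl⟩ := (segment_eq_image' ℝ x y) ▸ hz
    simp only [add_sub_cancel_left, norm_smul, Real.norm_of_nonneg hc.1]
    exact mul_le_of_le_one_left (norm_nonneg _) hc.2

/-- The squared gradient of a function with Lipschitz gradient is controlled by the distance to an
upper bound of the function. -/
lemma LipschitzWith.norm_gradient_sq_le {f : E → ℝ} (hf : Differentiable ℝ f) {L : ℝ≥0}
    (hL : LipschitzWith L (gradient f)) (hL0 : 0 < L) {B : ℝ} (hB : ∀ x, f x ≤ B) (x : E) :
    ‖gradient f x‖ ^ 2 ≤ 4 * L * (B - f x) := by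
  -- the step `1 / (2 L)` maximizes the lower bound along the gradient
  have h := hL.add_inner_gradient_sub_le hf x (x + (1 / (2 * L : ℝ)) • gradient f x)
  rw [add_sub_cancel_left, inner_smul_right, real_inner_self_eq_norm_sq, norm_smul,
    Real.norm_of_nonneg (by positivity), mul_pow] at h
  have h2 := hB (x + (1 / (2 * L : ℝ)) • gradient f x)
  have hL' : (0 : ℝ) < L := hL0
  have h3 : 1 / (2 * L : ℝ) * ‖gradient f x‖ ^ 2
      - L * ((1 / (2 * L : ℝ)) ^ 2 * ‖gradient f x‖ ^ 2) = ‖gradient f x‖ ^ 2 / (4 * L) := by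
    field_simp
    ring
  have h4 : ‖gradient f x‖ ^ 2 / (4 * L) ≤ B - f x := by linarith
  rw [div_le_iff₀ (by positivity)] at h4
  linarith

end Descent

/-! ### Sums of martingale differences -/

section MartingaleDifferences

variable {Ω : Type*} {mΩ : MeasurableSpace Ω} {μ : Measure Ω} [IsFiniteMeasure μ]
  {ℱ : Filtration ℕ mΩ}

/-- Sums of real martingale differences with summable variances converge almost surely. -/
lemma ae_exists_tendsto_sum_of_summable_integral_sq {ξ : ℕ → Ω → ℝ}
    (hmeas : ∀ t, StronglyMeasurable[ℱ (t + 1)] (ξ t)) (hL2 : ∀ t, MemLp (ξ t) 2 μ)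
    (hzero : ∀ t, μ[ξ t | ℱ t] =ᵐ[μ] 0) (hsum : Summable fun t => ∫ ω, ξ t ω ^ 2 ∂μ) :
    ∀ᵐ ω ∂μ, ∃ c, Tendsto (fun T => ∑ t ∈ Finset.range T, ξ t ω) atTop (𝓝 c) := by
  set W : ℕ → Ω → ℝ := fun T ω => ∑ t ∈ Finset.range T, ξ t ω with hWdef
  have hWsucc : ∀ T, W (T + 1) = W T + ξ T := fun T => by
    ext ω; simp [hWdef, Finset.sum_range_succ]
  have hWL2 : ∀ T, MemLp (W T) 2 μ := fun T => memLp_finsetSum _ fun t _ => hL2 t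
  have hWad : StronglyAdapted ℱ W := fun T =>
    Finset.stronglyMeasurable_fun_sum _ fun t ht =>
      (hmeas t).mono (ℱ.mono (by simpa using ht))
  have hint : ∀ t, Integrable (ξ t) μ := fun t => (hL2 t).integrable one_le_two
  have hmart : Martingale W ℱ μ := by
    refine martingale_of_condExp_sub_eq_zero_nat hWad
      (fun T => (hWL2 T).integrable one_le_two) fun T => ?_
    rw [hWsucc T, add_sub_cancel_left]
    exact hzero T
  have hcross : ∀ T, ∫ ω, W T ω * ξ T ω ∂μ = 0 := by
    intro T
    have hi : Integrable (W T * ξ T) μ := (hWL2 T).integrable_mul (hL2 T)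
    have h1 := condExp_mul_of_stronglyMeasurable_left (hWad T) hi (hint T)
    have h2 : μ[W T * ξ T | ℱ T] =ᵐ[μ] 0 := by
      filter_upwards [h1, hzero T] with ω h h'
      rw [h, Pi.mul_apply, h']
      simp
    have h3 := integral_condExp (μ := μ) (ℱ.le T) (f := W T * ξ T)
    rw [integral_congr_ae h2] at h3
    simpa using h3.symm
  have hWsq : ∀ T, ∫ ω, W T ω ^ 2 ∂μ = ∑ t ∈ Finset.range T, ∫ ω, ξ t ω ^ 2 ∂μ := by
    intro T
    induction T with
    | zero => simp [hWdef]
    | succ T ih =>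
      rw [Finset.sum_range_succ, ← ih, hWsucc]
      have hi : Integrable (fun ω => W T ω * ξ T ω) μ := (hWL2 T).integrable_mul (hL2 T)
      have : ∀ ω, (W T + ξ T) ω ^ 2 = W T ω ^ 2 + 2 * (W T ω * ξ T ω) + ξ T ω ^ 2 := by
        intro ω; simp only [Pi.add_apply]; ring
      simp_rw [this]
      have hi' : Integrable (fun ω => W T ω ^ 2 + 2 * (W T ω * ξ T ω)) μ :=
        (hWL2 T).integrable_sq.add (hi.const_mul 2)
      rw [integral_add hi' (hL2 T).integrable_sq,
        integral_add (hWL2 T).integrable_sq (hi.const_mul 2), integral_const_mul, hcross]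
      simp
  refine hmart.submartingale.exists_ae_tendsto_of_bdd
    (R := (μ.real Set.univ + ∑' t, ∫ ω, ξ t ω ^ 2 ∂μ).toNNReal) fun T => ?_
  have hWint := (hWL2 T).integrable one_le_two
  rw [eLpNorm_one_eq_lintegral_enorm, ← ofReal_integral_norm_eq_lintegral_enorm hWint]
  refine ENNReal.ofReal_le_ofReal ?_
  calc ∫ ω, ‖W T ω‖ ∂μ ≤ ∫ ω, (1 + W T ω ^ 2) ∂μ := by
        refine integral_mono hWint.norm ((integrable_const _).add (hWL2 T).integrable_sq) ?_
        intro ω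
        simp only [Real.norm_eq_abs]
        nlinarith [sq_abs (W T ω), sq_nonneg (|W T ω| - 1), abs_nonneg (W T ω)]
    _ ≤ μ.real Set.univ + ∑' t, ∫ ω, ξ t ω ^ 2 ∂μ := by
        rw [integral_add (integrable_const _) (hWL2 T).integrable_sq, hWsq]
        simp only [integral_const, smul_eq_mul, mul_one]
        gcongr
        exact hsum.sum_le_tsum _ fun t _ => integral_nonneg fun ω => sq_nonneg _

/-- Sums of martingale differences with summable variances in a Euclidean space converge almost
surely. -/
lemma ae_exists_tendsto_sum_of_summable_integral_norm_sq {E : Type*} [NormedAddCommGroup E]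
    [InnerProductSpace ℝ E] [FiniteDimensional ℝ E] {ξ : ℕ → Ω → E}
    (hmeas : ∀ t, StronglyMeasurable[ℱ (t + 1)] (ξ t)) (hL2 : ∀ t, MemLp (ξ t) 2 μ)
    (hzero : ∀ t, μ[ξ t | ℱ t] =ᵐ[μ] 0) (hsum : Summable fun t => ∫ ω, ‖ξ t ω‖ ^ 2 ∂μ) :
    ∀ᵐ ω ∂μ, ∃ c, Tendsto (fun T => ∑ t ∈ Finset.range T, ξ t ω) atTop (𝓝 c) := by
  set b := stdOrthonormalBasis ℝ E
  have hnorm : ∀ j, ∀ t ω, inner ℝ (b j) (ξ t ω) ^ 2 ≤ ‖ξ t ω‖ ^ 2 := by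
    intro j t ω
    have h := abs_real_inner_le_norm (b j) (ξ t ω)
    rw [b.orthonormal.norm_eq_one, one_mul] at h
    rw [← sq_abs]
    gcongr
  have h : ∀ j, ∀ᵐ ω ∂μ, ∃ c,
      Tendsto (fun T => ∑ t ∈ Finset.range T, inner ℝ (b j) (ξ t ω)) atTop (𝓝 c) := by
    intro j
    refine ae_exists_tendsto_sum_of_summable_integral_sq (ℱ := ℱ)
      (fun t => stronglyMeasurable_const.inner (hmeas t))
      (fun t => (hL2 t).const_inner (b j)) (fun t => ?_) ?_
    · have h1 := (innerSL ℝ (b j)).comp_condExp_comm (m := ℱ t)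
        ((hL2 t).integrable one_le_two)
      refine (h1.symm.trans ?_)
      filter_upwards [hzero t] with ω hω
      simp [hω]
    · refine Summable.of_nonneg_of_le (fun t => integral_nonneg fun ω => sq_nonneg _)
        (fun t => integral_mono ((hL2 t).const_inner (b j)).integrable_sq
          ((memLp_two_iff_integrable_sq_norm (hL2 t).1).1 (hL2 t)) (hnorm j t)) hsum
  filter_upwards [ae_all_iff.2 h] with ω hω
  choose c hc using hω
  refine ⟨∑ j, c j • b j, ?_⟩
  have h2 : Tendsto (fun T => ∑ j, (∑ t ∈ Finset.range T, inner ℝ (b j) (ξ t ω)) • b j) atTop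
      (𝓝 (∑ j, c j • b j)) :=
    tendsto_finsetSum _ fun j _ => (hc j).smul_const (b j)
  refine h2.congr fun T => ?_
  simp_rw [← inner_sum]
  exact b.sum_repr' _

end MartingaleDifferences

/-! ### Stochastic gradient ascent -/

section StochasticAscent

variable {E : Type*} [NormedAddCommGroup E] [InnerProductSpace ℝ E] [FiniteDimensional ℝ E]
  {Ω : Type*} {mΩ : MeasurableSpace Ω}

/-- A discrete Gronwall inequality for the expected gaps `x`, squared gradients `y` and squared
steps `z` of stochastic gradient ascent. -/
lemma summable_of_ascent_recursion {α x y z : ℕ → ℝ} {a b c : ℝ} (ha : 0 ≤ a) (hb : 0 ≤ b)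
    (hc : 0 ≤ c)
    (hα_pos : ∀ t, 0 < α t) (hα_sq : Summable fun t => α t ^ 2)
    (hx0 : ∀ t, 0 ≤ x t) (hy0 : ∀ t, 0 ≤ y t) (hz0 : ∀ t, 0 ≤ z t)
    (hx : ∀ t, x (t + 1) ≤ x t - α t * y t + a * (α t ^ 2 * z t))
    (hz : ∀ t, z t ≤ b * (1 + y t)) (hy : ∀ t, y t ≤ c * x t) :
    (∃ K, ∀ t, x t ≤ K) ∧ (Summable fun t => α t ^ 2 * (1 + y t)) ∧
      (Summable fun t => α t ^ 2 * z t) ∧ Summable fun t => α t * y t := by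
  have hα2 : ∀ t, 0 ≤ α t ^ 2 := fun t => sq_nonneg _
  set d : ℝ := a * (b * (1 + c)) with hd
  have hd0 : 0 ≤ d := by positivity
  have hrec : ∀ t, x (t + 1) + 1 ≤ (1 + d * α t ^ 2) * (x t + 1) := by
    intro t
    have h1 : z t ≤ b * ((1 + c) * (x t + 1)) := by
      refine (hz t).trans (mul_le_mul_of_nonneg_left ?_ hb)
      nlinarith [hy t, hx0 t]
    have h2 : a * (α t ^ 2 * z t) ≤ a * (α t ^ 2 * (b * ((1 + c) * (x t + 1)))) := by
      have := hα2 t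
      gcongr
    have h3 := mul_nonneg (hα_pos t).le (hy0 t)
    have h4 : a * (α t ^ 2 * (b * ((1 + c) * (x t + 1)))) = d * α t ^ 2 * (x t + 1) := by
      rw [hd]; ring
    linarith [hx t]
  have hexp : ∀ t, x t + 1 ≤ (x 0 + 1) * Real.exp (d * ∑ s ∈ Finset.range t, α s ^ 2) := by
    intro t
    induction t with
    | zero => simp
    | succ t ih =>
      rw [Finset.sum_range_succ, mul_add, Real.exp_add, ← mul_assoc]
      calc x (t + 1) + 1 ≤ (1 + d * α t ^ 2) * (x t + 1) := hrec t
        _ ≤ Real.exp (d * α t ^ 2) * (x t + 1) := by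
            have := hx0 t
            gcongr
            linarith [Real.add_one_le_exp (d * α t ^ 2)]
        _ ≤ Real.exp (d * α t ^ 2)
            * ((x 0 + 1) * Real.exp (d * ∑ s ∈ Finset.range t, α s ^ 2)) := by gcongr
        _ = _ := by ring
  set K : ℝ := (x 0 + 1) * Real.exp (d * ∑' s, α s ^ 2) with hK
  have hxK : ∀ t, x t ≤ K := by
    intro t
    have h1 : (x 0 + 1) * Real.exp (d * ∑ s ∈ Finset.range t, α s ^ 2) ≤ K := by
      have := hx0 0
      rw [hK]
      gcongr
      exact hα_sq.sum_le_tsum _ fun s _ => hα2 s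
    linarith [hexp t]
  have hsy : Summable fun t => α t ^ 2 * (1 + y t) := by
    refine Summable.of_nonneg_of_le (fun t => mul_nonneg (hα2 t) (by linarith [hy0 t]))
      (fun t => ?_) (hα_sq.mul_right (1 + c * K))
    have := hα2 t
    have := hy t
    have := mul_le_mul_of_nonneg_left (hxK t) hc
    gcongr
    linarith
  have hsz : Summable fun t => α t ^ 2 * z t := by
    refine Summable.of_nonneg_of_le (fun t => mul_nonneg (hα2 t) (hz0 t)) (fun t => ?_)
      (hsy.mul_left b)
    have := mul_le_mul_of_nonneg_left (hz t) (hα2 t)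
    linarith
  refine ⟨⟨K, hxK⟩, hsy, hsz, ?_⟩
  refine summable_of_sum_range_le (c := x 0 + a * ∑' t, α t ^ 2 * z t)
    (fun t => mul_nonneg (hα_pos t).le (hy0 t)) fun T => ?_
  have htel : ∑ t ∈ Finset.range T, α t * y t
      ≤ x 0 - x T + a * ∑ t ∈ Finset.range T, α t ^ 2 * z t := by
    induction T with
    | zero => simp
    | succ T ih =>
      rw [Finset.sum_range_succ, Finset.sum_range_succ]
      linarith [hx T]
  have h1 : ∑ t ∈ Finset.range T, α t ^ 2 * z t ≤ ∑' t, α t ^ 2 * z t :=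
    hsz.sum_le_tsum _ fun t _ => mul_nonneg (hα2 t) (hz0 t)
  have h2 := mul_le_mul_of_nonneg_left h1 ha
  linarith [hx0 T]

/-- Integrals of nonnegative functions that are summable make the functions summable almost
everywhere. -/
lemma ae_summable_of_summable_integral {β : Type*} {mβ : MeasurableSpace β} {ν : Measure β}
    {ι : Type*} [Countable ι] {F : ι → β → ℝ} (hF0 : ∀ i ω, 0 ≤ F i ω)
    (hF : ∀ i, Integrable (F i) ν)
    (hs : Summable fun i => ∫ ω, F i ω ∂ν) : ∀ᵐ ω ∂ν, Summable fun i => F i ω := by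
  have h1 : ∫⁻ ω, ∑' i, ENNReal.ofReal (F i ω) ∂ν ≠ ∞ := by
    rw [lintegral_tsum fun i => (hF i).aemeasurable.ennreal_ofReal]
    have : ∀ i, ∫⁻ ω, ENNReal.ofReal (F i ω) ∂ν = ENNReal.ofReal (∫ ω, F i ω ∂ν) := fun i =>
      (ofReal_integral_eq_lintegral_ofReal (hF i) (ae_of_all _ (hF0 i))).symm
    simp_rw [this]
    exact hs.tsum_ofReal_ne_top
  have h2 := ae_lt_top' (AEMeasurable.tsum fun i =>
    (hF i).aemeasurable.ennreal_ofReal) h1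
  filter_upwards [h2] with ω hω
  have := ENNReal.summable_toReal hω.ne
  simpa [ENNReal.toReal_ofReal (hF0 _ ω)] using this

/-- Stochastic gradient ascent on a function that is bounded above and has a Lipschitz gradient,
under a finite measure for which the initial value is integrable. The noise
condition is only needed in expectation. -/
theorem ae_tendsto_of_integrable_initial {ν : Measure Ω} [IsFiniteMeasure ν]
    {ℱ : Filtration ℕ mΩ} {f : E → ℝ} (hf : Differentiable ℝ f) {L : ℝ≥0} (hL0 : 0 < L)
    (hL : LipschitzWith L (gradient f)) {B : ℝ} (hB : ∀ x, f x ≤ B)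
    {α : ℕ → ℝ} (hα_pos : ∀ t, 0 < α t)
    (hα_sum : Tendsto (fun T => ∑ t ∈ Finset.range T, α t) atTop atTop)
    (hα_sq : Summable fun t => α t ^ 2)
    {θ D : ℕ → Ω → E} (hθ : StronglyAdapted ℱ θ)
    (h_update : ∀ t ω, θ (t + 1) ω = θ t ω + α t • D t ω)
    (hD_int : ∀ t, Integrable (D t) ν)
    (hD_unbiased : ∀ t, ν[D t | ℱ t] =ᵐ[ν] fun ω => gradient f (θ t ω))
    {C : ℝ≥0}
    (hD_noise : ∀ t, ∫⁻ ω, ‖D t ω - gradient f (θ t ω)‖ₑ ^ 2 ∂ν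
      ≤ ∫⁻ ω, C * (1 + ‖gradient f (θ t ω)‖ₑ ^ 2) ∂ν)
    (h0 : Integrable (fun ω => f (θ 0 ω)) ν) :
    ∀ᵐ ω ∂ν, (∃ J : ℝ, Tendsto (fun t => f (θ t ω)) atTop (𝓝 J)) ∧
      Tendsto (fun t => gradient f (θ t ω)) atTop (𝓝 0) := by
  set h : ℕ → Ω → ℝ := fun t ω => B - f (θ t ω) with hh
  set g : ℕ → Ω → E := fun t ω => gradient f (θ t ω) with hgdef
  set w : ℕ → Ω → E := fun t ω => D t ω - g t ω with hwdef
  have hh0 : ∀ t ω, 0 ≤ h t ω := fun t ω => sub_nonneg.2 (hB _)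
  have hg_le : ∀ t ω, ‖g t ω‖ ^ 2 ≤ 4 * L * h t ω := fun t ω =>
    hL.norm_gradient_sq_le hf hL0 hB _
  have hh_ad : StronglyAdapted ℱ h := fun t =>
    stronglyMeasurable_const.sub (hf.continuous.comp_stronglyMeasurable (hθ t))
  have hg_ad : StronglyAdapted ℱ g := fun t => hL.continuous.comp_stronglyMeasurable (hθ t)
  have hD_eq : ∀ t, D t = fun ω => (α t)⁻¹ • (θ (t + 1) ω - θ t ω) := by
    intro t
    ext1 ω
    rw [h_update, add_sub_cancel_left, inv_smul_smul₀ (hα_pos t).ne']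
  have hD_ad : ∀ t, StronglyMeasurable[ℱ (t + 1)] (D t) := by
    intro t
    rw [hD_eq]
    exact ((hθ (t + 1)).sub ((hθ t).mono (ℱ.mono t.le_succ))).const_smul _
  have hw_ad : ∀ t, StronglyMeasurable[ℱ (t + 1)] (w t) := fun t =>
    (hD_ad t).sub ((hg_ad t).mono (ℱ.mono t.le_succ))
  -- the basic inequality of one step
  have hstep : ∀ t ω, h (t + 1) ω ≤ h t ω - α t * inner ℝ (g t ω) (D t ω)
      + L * (α t ^ 2 * ‖D t ω‖ ^ 2) := by
    intro t ω
    have := hL.add_inner_gradient_sub_le hf (θ t ω) (θ (t + 1) ω)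
    rw [h_update, add_sub_cancel_left, inner_smul_right, norm_smul,
      Real.norm_of_nonneg (hα_pos t).le, mul_pow] at this
    simp only [hh, hgdef]
    rw [h_update]
    linarith
  -- integrability
  have hgL2_of : ∀ t, Integrable (h t) ν → MemLp (g t) 2 ν := by
    intro t ht
    have hm : AEStronglyMeasurable (g t) ν := ((hg_ad t).mono (ℱ.le t)).aestronglyMeasurable
    rw [memLp_two_iff_integrable_sq_norm hm]
    refine (ht.const_mul (4 * L : ℝ)).mono' (hm.norm.pow 2) (ae_of_all _ fun ω => ?_)
    rw [Real.norm_of_nonneg (sq_nonneg _)]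
    exact hg_le t ω
  have hnoise : ∀ t, MemLp (g t) 2 ν → MemLp (w t) 2 ν ∧
      ∫ ω, ‖w t ω‖ ^ 2 ∂ν ≤ C * (ν.real Set.univ + ∫ ω, ‖g t ω‖ ^ 2 ∂ν) := by
    intro t ht
    have hm : AEStronglyMeasurable (w t) ν :=
      ((hw_ad t).mono (ℱ.le _)).aestronglyMeasurable
    have hgi : Integrable (fun ω => (C : ℝ) * (1 + ‖g t ω‖ ^ 2)) ν :=
      (((integrable_const 1).add ((memLp_two_iff_integrable_sq_norm ht.1).1 ht))).const_mul _
    have e1 : ∀ ω, (C : ℝ≥0∞) * (1 + ‖g t ω‖ₑ ^ 2)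
        = ENNReal.ofReal ((C : ℝ) * (1 + ‖g t ω‖ ^ 2)) := by
      intro ω
      rw [ENNReal.ofReal_mul (p := (C : ℝ)) C.2, ENNReal.ofReal_add zero_le_one (sq_nonneg _),
        ENNReal.ofReal_pow (norm_nonneg _), ofReal_norm, ENNReal.ofReal_one,
        ENNReal.ofReal_coe_nnreal]
    have e2 : ∀ ω, ‖w t ω‖ₑ ^ 2 = ENNReal.ofReal (‖w t ω‖ ^ 2) := fun ω => by
      rw [ENNReal.ofReal_pow (norm_nonneg _), ofReal_norm]
    have h1 : ∫⁻ ω, ENNReal.ofReal (‖w t ω‖ ^ 2) ∂ν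
        ≤ ENNReal.ofReal (∫ ω, (C : ℝ) * (1 + ‖g t ω‖ ^ 2) ∂ν) := by
      rw [ofReal_integral_eq_lintegral_ofReal hgi (ae_of_all _ fun ω => by positivity)]
      simp_rw [← e1, ← e2]
      exact hD_noise t
    have hwi : Integrable (fun ω => ‖w t ω‖ ^ 2) ν := by
      refine ⟨hm.norm.pow 2, ?_⟩
      rw [hasFiniteIntegral_iff_ofReal (ae_of_all _ fun ω => sq_nonneg _)]
      exact h1.trans_lt ENNReal.ofReal_lt_top
    refine ⟨(memLp_two_iff_integrable_sq_norm hm).2 hwi, ?_⟩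
    rw [← ofReal_integral_eq_lintegral_ofReal hwi (ae_of_all _ fun ω => sq_nonneg _),
      ENNReal.ofReal_le_ofReal_iff (integral_nonneg fun ω => by positivity)] at h1
    rw [integral_const_mul, integral_add (integrable_const _)
      ((memLp_two_iff_integrable_sq_norm ht.1).1 ht)] at h1
    simpa using h1
  have hDw : ∀ t, D t = fun ω => w t ω + g t ω := fun t => by ext1 ω; simp [hwdef]
  have hDL2_of : ∀ t, MemLp (g t) 2 ν → MemLp (D t) 2 ν := by
    intro t ht
    rw [hDw]
    exact (hnoise t ht).1.add ht
  have hinner_of : ∀ u v : Ω → E, MemLp u 2 ν → MemLp v 2 ν →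
      Integrable (fun ω => (inner ℝ (u ω) (v ω) : ℝ)) ν := by
    intro u v hu hv
    refine (((memLp_two_iff_integrable_sq_norm hu.1).1 hu).add
      ((memLp_two_iff_integrable_sq_norm hv.1).1 hv)).mono' (hu.1.inner hv.1)
      (ae_of_all _ fun ω => ?_)
    have := norm_inner_le_norm (𝕜 := ℝ) (u ω) (v ω)
    simp only [Pi.add_apply]
    nlinarith [sq_nonneg (‖u ω‖ - ‖v ω‖), norm_nonneg (u ω), norm_nonneg (v ω)]
  have hh_int : ∀ t, Integrable (h t) ν := by
    intro t
    induction t with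
    | zero => exact (integrable_const B).sub h0
    | succ t ih =>
      have hg2 := hgL2_of t ih
      have hD2 := hDL2_of t hg2
      have hR : Integrable (fun ω => h t ω - α t * inner ℝ (g t ω) (D t ω)
          + L * (α t ^ 2 * ‖D t ω‖ ^ 2)) ν :=
        (ih.sub ((hinner_of _ _ hg2 hD2).const_mul _)).add
          ((((memLp_two_iff_integrable_sq_norm hD2.1).1 hD2).const_mul _).const_mul _)
      refine hR.mono' ((hh_ad (t + 1)).mono (ℱ.le _)).aestronglyMeasurable
        (ae_of_all _ fun ω => ?_)
      rw [Real.norm_of_nonneg (hh0 _ _)]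
      exact hstep t ω
  have hg2 : ∀ t, MemLp (g t) 2 ν := fun t => hgL2_of t (hh_int t)
  have hw2 : ∀ t, MemLp (w t) 2 ν := fun t => (hnoise t (hg2 t)).1
  have hD2 : ∀ t, MemLp (D t) 2 ν := fun t => hDL2_of t (hg2 t)
  have hsq : ∀ {u : Ω → E}, MemLp u 2 ν → Integrable (fun ω => ‖u ω‖ ^ 2) ν := fun hu =>
    (memLp_two_iff_integrable_sq_norm hu.1).1 hu
  -- the noise is a sequence of martingale differences
  have hw_zero : ∀ t, ν[w t | ℱ t] =ᵐ[ν] 0 := by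
    intro t
    have h1 := condExp_sub (hD_int t) ((hg2 t).integrable one_le_two) (ℱ t)
    have h2 : ν[g t | ℱ t] = g t :=
      condExp_of_stronglyMeasurable (ℱ.le t) (hg_ad t) ((hg2 t).integrable one_le_two)
    refine h1.trans ?_
    filter_upwards [hD_unbiased t] with ω hω
    rw [Pi.sub_apply, h2, hω]
    exact sub_self _
  have hgw_zero : ∀ t, ν[fun ω => (inner ℝ (g t ω) (w t ω) : ℝ) | ℱ t] =ᵐ[ν] 0 := by
    intro t
    have h1 := condExp_bilin_of_stronglyMeasurable_left (m := ℱ t) (μ := ν) (innerSL ℝ (E := E))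
      (hg_ad t) (g := w t) (hinner_of _ _ (hg2 t) (hw2 t)) ((hw2 t).integrable one_le_two)
    refine h1.trans ?_
    filter_upwards [hw_zero t] with ω hω
    simp [hω]
  have hgw_int : ∀ t, ∫ ω, (inner ℝ (g t ω) (w t ω) : ℝ) ∂ν = 0 := by
    intro t
    have := integral_condExp (μ := ν) (ℱ.le t) (f := fun ω => (inner ℝ (g t ω) (w t ω) : ℝ))
    rw [integral_congr_ae (hgw_zero t)] at this
    simpa using this.symm
  have hgD : ∀ t ω, (inner ℝ (g t ω) (D t ω) : ℝ) = inner ℝ (g t ω) (w t ω) + ‖g t ω‖ ^ 2 := by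
    intro t ω
    rw [hDw, inner_add_right, real_inner_self_eq_norm_sq]
  -- the recursion of the expectations
  have hrec := summable_of_ascent_recursion (α := α) (x := fun t => ∫ ω, h t ω ∂ν)
    (y := fun t => ∫ ω, ‖g t ω‖ ^ 2 ∂ν) (z := fun t => ∫ ω, ‖D t ω‖ ^ 2 ∂ν)
    (a := L) (b := 2 * (C * (ν.real Set.univ + 1) + 1)) (c := 4 * L) L.2
    (by positivity) (by positivity)
    hα_pos hα_sq (fun t => integral_nonneg (hh0 t))
    (fun t => integral_nonneg fun ω => sq_nonneg _) (fun t => integral_nonneg fun ω => sq_nonneg _)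
    (fun t => by
      have i1 := hinner_of _ _ (hg2 t) (hw2 t)
      have i2 : Integrable (fun ω => (inner ℝ (g t ω) (w t ω) : ℝ) + ‖g t ω‖ ^ 2) ν :=
        i1.add (hsq (hg2 t))
      have i3 : Integrable (fun ω => h t ω
          - α t * ((inner ℝ (g t ω) (w t ω) : ℝ) + ‖g t ω‖ ^ 2)) ν :=
        (hh_int t).sub (i2.const_mul _)
      have i4 : Integrable (fun ω => (L : ℝ) * (α t ^ 2 * ‖D t ω‖ ^ 2)) ν :=
        ((hsq (hD2 t)).const_mul _).const_mul _
      have := integral_mono (hh_int (t + 1)) (i3.add i4) (fun ω => by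
        have := hstep t ω
        rw [hgD] at this
        exact this)
      refine this.trans_eq ?_
      simp only [Pi.add_apply]
      rw [integral_add i3 i4, integral_sub (hh_int t) (i2.const_mul _), integral_const_mul,
        integral_add i1 (hsq (hg2 t)), hgw_int, zero_add, integral_const_mul, integral_const_mul])
    (fun t => by
      have h1 : ∫ ω, ‖D t ω‖ ^ 2 ∂ν ≤ ∫ ω, (2 * ‖w t ω‖ ^ 2 + 2 * ‖g t ω‖ ^ 2) ∂ν := by
        refine integral_mono (hsq (hD2 t)) (((hsq (hw2 t)).const_mul 2).add
          ((hsq (hg2 t)).const_mul 2)) fun ω => ?_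
        have : ‖D t ω‖ ≤ ‖w t ω‖ + ‖g t ω‖ := by rw [hDw]; exact norm_add_le _ _
        simp only
        nlinarith [sq_nonneg (‖w t ω‖ - ‖g t ω‖), norm_nonneg (D t ω)]
      rw [integral_add ((hsq (hw2 t)).const_mul 2) ((hsq (hg2 t)).const_mul 2),
        integral_const_mul, integral_const_mul] at h1
      have h2 := (hnoise t (hg2 t)).2
      have h3 : 0 ≤ ∫ ω, ‖g t ω‖ ^ 2 ∂ν := integral_nonneg fun ω => sq_nonneg _
      have h4 : (0 : ℝ) ≤ C := C.2
      have h5 : 0 ≤ ν.real Set.univ := measureReal_nonneg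
      nlinarith [mul_nonneg h4 h3, mul_nonneg h4 h5, mul_nonneg (mul_nonneg h4 h5) h3])
    (fun t => by
      rw [← integral_const_mul]
      exact integral_mono (hsq (hg2 t)) ((hh_int t).const_mul _) (hg_le t))
  obtain ⟨⟨K, hK⟩, hsum1, hsumD, hsumg⟩ := hrec
  -- almost sure summability
  have hae_g : ∀ᵐ ω ∂ν, Summable fun t => α t * ‖g t ω‖ ^ 2 := by
    refine ae_summable_of_summable_integral
      (fun t ω => mul_nonneg (hα_pos t).le (sq_nonneg _))
      (fun t => (hsq (hg2 t)).const_mul _) ?_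
    simp_rw [integral_const_mul]
    exact hsumg
  have hae_D : ∀ᵐ ω ∂ν, Summable fun t => α t ^ 2 * ‖D t ω‖ ^ 2 := by
    refine ae_summable_of_summable_integral
      (fun t ω => by positivity)
      (fun t => (hsq (hD2 t)).const_mul _) ?_
    simp_rw [integral_const_mul]
    exact hsumD
  have hae_w : ∀ᵐ ω ∂ν, ∃ W, Tendsto (fun T => ∑ t ∈ Finset.range T, α t • w t ω) atTop (𝓝 W) := by
    refine ae_exists_tendsto_sum_of_summable_integral_norm_sq (ℱ := ℱ)
      (ξ := fun t ω => α t • w t ω)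
      (fun t => (hw_ad t).const_smul _) (fun t => (hw2 t).const_smul _) (fun t => ?_) ?_
    · refine (condExp_smul (α t) (w t) (ℱ t)).trans ?_
      filter_upwards [hw_zero t] with ω hω
      simp [hω]
    · refine Summable.of_nonneg_of_le (fun t => integral_nonneg fun ω => sq_nonneg _)
        (fun t => ?_) (hsum1.mul_left (C * (ν.real Set.univ + 1)))
      simp_rw [norm_smul, mul_pow]
      rw [integral_const_mul, Real.norm_eq_abs, sq_abs]
      have h2 := (hnoise t (hg2 t)).2
      have h3 : 0 ≤ ∫ ω, ‖g t ω‖ ^ 2 ∂ν := integral_nonneg fun ω => sq_nonneg _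
      have h4 : (0 : ℝ) ≤ C := C.2
      have h5 : 0 ≤ ν.real Set.univ := measureReal_nonneg
      have h6 : ∫ ω, ‖w t ω‖ ^ 2 ∂ν
          ≤ C * (ν.real Set.univ + 1) * (1 + ∫ ω, ‖g t ω‖ ^ 2 ∂ν) := by
        nlinarith [mul_nonneg h4 h3, mul_nonneg h4 h5, mul_nonneg (mul_nonneg h4 h5) h3]
      have := mul_le_mul_of_nonneg_left h6 (sq_nonneg (α t))
      linarith
  -- convergence of the values, by the supermartingale convergence theorem
  have hae_h : ∀ᵐ ω ∂ν, ∃ c, Tendsto (fun t => h t ω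
      - ∑ s ∈ Finset.range t, L * (α s ^ 2 * ‖D s ω‖ ^ 2)) atTop (𝓝 c) := by
    set Y : ℕ → Ω → ℝ := fun t ω => h t ω
      - ∑ s ∈ Finset.range t, L * (α s ^ 2 * ‖D s ω‖ ^ 2) with hY
    have hSint : ∀ t, Integrable
        (fun ω => ∑ s ∈ Finset.range t, L * (α s ^ 2 * ‖D s ω‖ ^ 2)) ν := fun t =>
      integrable_finsetSum _ fun s _ => ((hsq (hD2 s)).const_mul _).const_mul _
    have hYint : ∀ t, Integrable (Y t) ν := fun t => (hh_int t).sub (hSint t)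
    have hYad : StronglyAdapted ℱ Y := by
      intro t
      refine (hh_ad t).sub (Finset.stronglyMeasurable_fun_sum _ fun s hs => ?_)
      have := ((hD_ad s).mono (ℱ.mono (show s + 1 ≤ t by simpa using hs))).norm
      exact ((this.pow 2).const_mul _).const_mul _
    have hYsuper : Supermartingale Y ℱ ν := by
      refine supermartingale_of_condExp_sub_nonneg_nat hYad hYint fun t => ?_
      have i1 := (hinner_of _ _ (hg2 t) (hw2 t)).const_mul (α t)
      have hle : (fun ω => α t * (inner ℝ (g t ω) (w t ω) : ℝ)) ≤ᵐ[ν] Y t - Y (t + 1) := by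
        refine ae_of_all _ fun ω => ?_
        have h1 := hstep t ω
        rw [hgD] at h1
        have h2 := mul_nonneg (hα_pos t).le (sq_nonneg ‖g t ω‖)
        simp only [hY, Pi.sub_apply, Finset.sum_range_succ]
        linarith
      have h2 := condExp_mono (m := ℱ t) i1 ((hYint t).sub (hYint (t + 1))) hle
      have h3 := condExp_smul (μ := ν) (α t) (fun ω => (inner ℝ (g t ω) (w t ω) : ℝ)) (ℱ t)
      filter_upwards [h2, h3, hgw_zero t] with ω a1 a2 a3
      have a4 : (ν[fun ω => α t * (inner ℝ (g t ω) (w t ω) : ℝ) | ℱ t]) ω = 0 := by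
        refine Eq.trans a2 ?_
        simp [a3]
      rw [a4] at a1
      exact a1
    have hR : ∀ t, eLpNorm ((-Y) t) 1 ν
        ≤ ((K + L * ∑' t, α t ^ 2 * ∫ ω, ‖D t ω‖ ^ 2 ∂ν).toNNReal : ℝ≥0) := by
      intro t
      rw [Pi.neg_apply, eLpNorm_neg, eLpNorm_one_eq_lintegral_enorm,
        ← ofReal_integral_norm_eq_lintegral_enorm (hYint t)]
      refine ENNReal.ofReal_le_ofReal ?_
      calc ∫ ω, ‖Y t ω‖ ∂ν
          ≤ ∫ ω, (h t ω + ∑ s ∈ Finset.range t, L * (α s ^ 2 * ‖D s ω‖ ^ 2)) ∂ν := by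
            refine integral_mono (hYint t).norm ((hh_int t).add (hSint t)) fun ω => ?_
            refine (norm_sub_le _ _).trans_eq ?_
            rw [Real.norm_of_nonneg (hh0 _ _), Real.norm_of_nonneg
              (Finset.sum_nonneg fun s _ => by positivity)]
        _ ≤ K + L * ∑' t, α t ^ 2 * ∫ ω, ‖D t ω‖ ^ 2 ∂ν := by
            rw [integral_add (hh_int t) (hSint t), integral_finsetSum _
              fun s _ => ((hsq (hD2 s)).const_mul _).const_mul _]
            simp_rw [integral_const_mul]
            rw [← Finset.mul_sum]
            gcongr
            · exact hK t
            · exact hsumD.sum_le_tsum _ fun s _ =>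
                mul_nonneg (sq_nonneg _) (integral_nonneg fun ω => sq_nonneg _)
    filter_upwards [hYsuper.neg.exists_ae_tendsto_of_bdd hR] with ω ⟨c, hc⟩
    refine ⟨-c, ?_⟩
    simpa using hc.neg
  have hα_zero : Tendsto α atTop (𝓝 0) := by
    have := hα_sq.tendsto_atTop_zero.sqrt
    simpa [Real.sqrt_sq (hα_pos _).le] using this
  filter_upwards [hae_g, hae_D, hae_w, hae_h] with ω h1 h2 ⟨W, hW⟩ ⟨c, hc⟩
  constructor
  · refine ⟨B - (c + ∑' s, L * (α s ^ 2 * ‖D s ω‖ ^ 2)), ?_⟩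
    have h3 := (hc.add (h2.mul_left (L : ℝ)).hasSum.tendsto_sum_nat).const_sub B
    refine h3.congr fun t => ?_
    simp [hh]
  · refine tendsto_zero_of_summable_mul_sq hL (x := fun t => θ t ω) (w := fun t => w t ω)
      hα_pos hα_sum hα_zero (fun t => ?_) h1 hW
    rw [h_update]
    simp [hwdef, hgdef]

/-- Stochastic gradient ascent with unbiased steps on a function that is bounded above and has a
Lipschitz gradient: almost surely, the values converge and the gradients tend to zero. The values
need not be integrable, so the argument localizes to the events on which the initial value is
bounded below. -/
theorem ae_tendsto_of_stochastic_gradient_ascent {μ : Measure Ω} [IsProbabilityMeasure μ]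
    {ℱ : Filtration ℕ mΩ} {f : E → ℝ} (hf : Differentiable ℝ f) {L : ℝ≥0}
    (hL : LipschitzWith L (gradient f)) (hB : BddAbove (Set.range f))
    {α : ℕ → ℝ} (hα_pos : ∀ t, 0 < α t)
    (hα_sum : Tendsto (fun T => ∑ t ∈ Finset.range T, α t) atTop atTop)
    (hα_sq : Summable fun t => α t ^ 2)
    {θ D : ℕ → Ω → E} (hθ : StronglyAdapted ℱ θ)
    (h_update : ∀ t ω, θ (t + 1) ω = θ t ω + α t • D t ω)
    (hD_int : ∀ t, Integrable (D t) μ)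
    (hD_unbiased : ∀ t, μ[D t | ℱ t] =ᵐ[μ] fun ω => gradient f (θ t ω))
    {C : ℝ≥0}
    (hD_noise : ∀ t, condLExp (ℱ t) μ (fun ω => ‖D t ω - gradient f (θ t ω)‖ₑ ^ 2)
      ≤ᵐ[μ] fun ω => C * (1 + ‖gradient f (θ t ω)‖ₑ ^ 2)) :
    ∀ᵐ ω ∂μ, (∃ J : ℝ, Tendsto (fun t => f (θ t ω)) atTop (𝓝 J)) ∧
      Tendsto (fun t => gradient f (θ t ω)) atTop (𝓝 0) := by
  obtain ⟨B, hB⟩ := hB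
  have hB' : ∀ x, f x ≤ B := fun x => hB ⟨x, rfl⟩
  have hf0 : StronglyMeasurable[ℱ 0] fun ω => f (θ 0 ω) :=
    hf.continuous.comp_stronglyMeasurable (hθ 0)
  set A : ℕ → Set Ω := fun k => {ω | -(k : ℝ) ≤ f (θ 0 ω)} with hA
  have hA0 : ∀ k, MeasurableSet[ℱ 0] (A k) := fun k =>
    hf0.measurable measurableSet_Ici
  have hAt : ∀ k t, MeasurableSet[ℱ t] (A k) := fun k t => ℱ.mono (zero_le (a := t)) _ (hA0 k)
  have hAm : ∀ k, MeasurableSet (A k) := fun k => ℱ.le 0 _ (hA0 k)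
  have hk : ∀ k, ∀ᵐ ω ∂μ.restrict (A k),
      (∃ J : ℝ, Tendsto (fun t => f (θ t ω)) atTop (𝓝 J)) ∧
        Tendsto (fun t => gradient f (θ t ω)) atTop (𝓝 0) := by
    intro k
    refine ae_tendsto_of_integrable_initial (ν := μ.restrict (A k)) (ℱ := ℱ) (L := L + 1) (C := C)
      hf (by positivity) (hL.weaken (by simp)) hB' hα_pos hα_sum hα_sq hθ h_update
      (fun t => (hD_int t).restrict) (fun t => ?_) (fun t => ?_) ?_
    · exact (condExp_restrict_ae_eq_restrict (ℱ.le t) (hAt k t) (hD_int t)).trans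
        (ae_restrict_of_ae (hD_unbiased t))
    · rw [← setLIntegral_condLExp (ℱ.le t) μ _ (hAt k t)]
      exact lintegral_mono_ae (ae_restrict_of_ae (hD_noise t))
    · refine Integrable.of_bound (hf0.mono (ℱ.le 0)).aestronglyMeasurable (max k |B|) ?_
      refine (ae_restrict_iff' (hAm k)).2 (ae_of_all _ fun ω hω => ?_)
      rw [Real.norm_eq_abs, abs_le]
      have h1 : -(k : ℝ) ≤ f (θ 0 ω) := hω
      constructor
      · linarith [le_max_left (k : ℝ) |B|]
      · linarith [le_max_right (k : ℝ) |B|, hB' (θ 0 ω), le_abs_self B]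
  have hall := ae_all_iff.2 fun k => (ae_restrict_iff' (hAm k)).1 (hk k)
  filter_upwards [hall] with ω hω
  obtain ⟨k, hk⟩ := exists_nat_ge (-f (θ 0 ω))
  exact hω k (show -(k : ℝ) ≤ f (θ 0 ω) by linarith)

end StochasticAscent

/-! ### Chains of step records -/

section Chain

set_option linter.unusedSectionVars false

variable {S E : Type*} [MeasurableSpace S] [MeasurableSpace E]

/-- The law of a sequence of step records: the first one is drawn from `κ` after a start
with law `d`, and each record `z` is followed by one drawn from `κ (nxt z)`. -/
noncomputable def chainMeasure (κ : Kernel S E) [IsMarkovKernel κ] {nxt : E → S}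
    (hn : Measurable nxt) (d : Measure S) : Measure (ℕ → E) :=
  Kernel.trajMeasure (X := fun _ => E) (κ ∘ₘ d) fun t =>
    κ.comap (fun h : (i : Finset.Iic t) → E => nxt (h ⟨t, by simp⟩)) (by fun_prop)

variable {κ : Kernel S E} [IsMarkovKernel κ] {nxt : E → S} (hn : Measurable nxt) (d : Measure S)

instance [IsProbabilityMeasure d] : IsProbabilityMeasure (chainMeasure κ hn d) := by
  unfold chainMeasure; infer_instance

lemma comap_comp_measure {β : Type*} [MeasurableSpace β] {g : β → S} (hg : Measurable g)
    (ν : Measure β) : (κ.comap g hg) ∘ₘ ν = κ ∘ₘ (ν.map g) := by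
  ext s hs
  rw [Measure.bind_apply hs (Kernel.aemeasurable _), Measure.bind_apply hs (Kernel.aemeasurable _),
    lintegral_map (κ.measurable_coe hs) hg]
  rfl

variable [IsProbabilityMeasure d]

/-- Given the records up to time `t`, the next record has the law `κ (nxt (ω t))`. -/
lemma chainMeasure_map_frestrictLe_succ (t : ℕ) :
    (chainMeasure κ hn d).map
        (fun ω => (Preorder.frestrictLe (π := fun _ => E) t ω, ω (t + 1)))
      = (chainMeasure κ hn d).map (Preorder.frestrictLe (π := fun _ => E) t) ⊗ₘ
        κ.comap (fun h : (i : Finset.Iic t) → E => nxt (h ⟨t, by simp⟩)) (by fun_prop) := by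
  unfold chainMeasure
  exact (Kernel.map_frestrictLe_trajMeasure_compProd_eq_map_trajMeasure (X := fun _ => E)).symm

lemma chainMeasure_map_zero : (chainMeasure κ hn d).map (fun ω => ω 0) = κ ∘ₘ d := by
  have h1 : (chainMeasure κ hn d).map (Preorder.frestrictLe (π := fun _ => E) 0)
      = (κ ∘ₘ d).map (MeasurableEquiv.piUnique (fun _ : Finset.Iic 0 => E)).symm := by
    unfold chainMeasure Kernel.trajMeasure
    rw [Measure.map_comp _ _ (by fun_prop), Kernel.traj_map_frestrictLe, Kernel.partialTraj_self]
    exact Measure.id_comp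
  have h2 : (fun ω : ℕ → E => ω 0)
      = (fun h : (i : Finset.Iic 0) → E => h ⟨0, by simp⟩)
        ∘ Preorder.frestrictLe (π := fun _ => E) 0 := rfl
  rw [h2, ← Measure.map_map (by fun_prop) (by fun_prop), h1,
    Measure.map_map (by fun_prop) (MeasurableEquiv.measurable _)]
  exact Measure.map_id

lemma chainMeasure_map_succ (t : ℕ) : (chainMeasure κ hn d).map (fun ω => ω (t + 1))
    = κ ∘ₘ ((chainMeasure κ hn d).map fun ω => nxt (ω t)) := by
  have h1 := congrArg Measure.snd (chainMeasure_map_frestrictLe_succ (κ := κ) hn d t)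
  have : IsProbabilityMeasure
      ((chainMeasure κ hn d).map (Preorder.frestrictLe (π := fun _ => E) t)) :=
    Measure.isProbabilityMeasure_map (by fun_prop)
  rw [Measure.snd_compProd, comap_comp_measure, Measure.map_map (by fun_prop) (by fun_prop),
    Measure.snd, Measure.map_map (by fun_prop) (by fun_prop)] at h1
  exact h1

/-- Every record is drawn from `κ`, after a random state. -/
lemma exists_chainMeasure_map_eq (t : ℕ) : ∃ ν : Measure S, IsProbabilityMeasure ν ∧
    (chainMeasure κ hn d).map (fun ω => ω t) = κ ∘ₘ ν := by
  cases t with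
  | zero => exact ⟨d, inferInstance, chainMeasure_map_zero hn d⟩
  | succ t => exact ⟨_, Measure.isProbabilityMeasure_map (Measurable.aemeasurable (by fun_prop)),
      chainMeasure_map_succ hn d t⟩

/-- A property that almost every step has from every state holds at all times. -/
lemma ae_chainMeasure_of_forall {q : E → Prop} (hq : MeasurableSet {z | q z})
    (h : ∀ s, ∀ᵐ z ∂κ s, q z) : ∀ᵐ ω ∂chainMeasure κ hn d, ∀ t, q (ω t) := by
  refine ae_all_iff.2 fun t => ?_
  obtain ⟨ν, _, hν⟩ := exists_chainMeasure_map_eq (κ := κ) hn d t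
  have := Measure.ae_comp_of_ae_ae (μ := ν) hq (ae_of_all _ h)
  rw [← hν] at this
  exact ae_of_ae_map (Measurable.aemeasurable (by fun_prop)) this

/-- If almost every record of the law `κ s` has the starting state `s`, then every
record starts where its predecessor ended. -/
lemma ae_chainMeasure_start_succ [Finite S] [MeasurableSingletonClass S] {st : E → S}
    (hst : Measurable st) (h : ∀ s, ∀ᵐ z ∂κ s, st z = s) :
    ∀ᵐ ω ∂chainMeasure κ hn d, ∀ t, st (ω (t + 1)) = nxt (ω t) := by
  refine ae_all_iff.2 fun t => ?_
  have : IsProbabilityMeasure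
      ((chainMeasure κ hn d).map (Preorder.frestrictLe (π := fun _ => E) t)) :=
    Measure.isProbabilityMeasure_map (by fun_prop)
  have hae := Measure.ae_compProd_of_ae_ae
    (μ := (chainMeasure κ hn d).map (Preorder.frestrictLe (π := fun _ => E) t))
    (κ := κ.comap (fun h : (i : Finset.Iic t) → E => nxt (h ⟨t, by simp⟩)) (by fun_prop))
    (p := fun x => st x.2 = nxt (x.1 ⟨t, by simp⟩))
    (measurableSet_eq_fun (by fun_prop) (by fun_prop)) (ae_of_all _ fun x => h _)
  rw [← chainMeasure_map_frestrictLe_succ] at hae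
  exact ae_of_ae_map (by fun_prop) hae

lemma integral_comp_measure {ν : Measure S} {φ : E → ℝ} (hφ : Integrable φ (κ ∘ₘ ν)) :
    ∫ z, φ z ∂(κ ∘ₘ ν) = ∫ s, ∫ z, φ z ∂κ s ∂ν := by
  rw [Measure.comp_eq_comp_const_apply] at hφ ⊢
  rw [Kernel.integral_comp hφ]
  rfl

variable [Finite S] [MeasurableSingletonClass S]

lemma integrable_comp_measure {F : Type*} [NormedAddCommGroup F] {ν : Measure S}
    [IsProbabilityMeasure ν] {φ : E → F}
    (hφm : StronglyMeasurable φ) (hφ : ∀ s, Integrable φ (κ s)) : Integrable φ (κ ∘ₘ ν) :=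
  (Measure.integrable_comp_iff hφm.aestronglyMeasurable).2
    ⟨ae_of_all _ hφ, Integrable.of_finite⟩

lemma integrable_chainMeasure {F : Type*} [NormedAddCommGroup F] {φ : E → F}
    (hφm : StronglyMeasurable φ) (hφ : ∀ s, Integrable φ (κ s)) (t : ℕ) :
    Integrable (fun ω => φ (ω t)) (chainMeasure κ hn d) := by
  obtain ⟨ν, _, hν⟩ := exists_chainMeasure_map_eq (κ := κ) hn d t
  have h := integrable_comp_measure (ν := ν) hφm hφ
  rw [← hν] at h
  exact h.comp_measurable (by fun_prop)

lemma integral_chainMeasure_succ {φ : E → ℝ}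
    (hφm : StronglyMeasurable φ) (hφ : ∀ s, Integrable φ (κ s)) (t : ℕ) :
    ∫ ω, φ (ω (t + 1)) ∂chainMeasure κ hn d
      = ∫ ω, (∫ z, φ z ∂κ (nxt (ω t))) ∂chainMeasure κ hn d := by
  have : IsProbabilityMeasure ((chainMeasure κ hn d).map fun ω => nxt (ω t)) :=
    Measure.isProbabilityMeasure_map (Measurable.aemeasurable (by fun_prop))
  have h := integral_comp_measure (κ := κ) (integrable_comp_measure
    (ν := (chainMeasure κ hn d).map fun ω => nxt (ω t)) hφm hφ)
  rw [← chainMeasure_map_succ, integral_map (Measurable.aemeasurable (by fun_prop)) hφm.aestronglyMeasurable,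
    integral_map (Measurable.aemeasurable (by fun_prop)) (measurable_of_finite _).aestronglyMeasurable] at h
  exact h

lemma integral_chainMeasure_zero {φ : E → ℝ}
    (hφm : StronglyMeasurable φ) (hφ : ∀ s, Integrable φ (κ s)) :
    ∫ ω, φ (ω 0) ∂chainMeasure κ hn d = ∫ s, ∫ z, φ z ∂κ s ∂d := by
  rw [← integral_comp_measure (integrable_comp_measure hφm hφ), ← chainMeasure_map_zero hn,
    integral_map (Measurable.aemeasurable (by fun_prop)) hφm.aestronglyMeasurable]

/-- The Markov property: in an expectation, a bounded function of the next record may be replaced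
by its mean under `κ`. -/
lemma integral_mul_chainMeasure_succ {t : ℕ} {X : ((i : Finset.Iic t) → E) → ℝ}
    (hX : Measurable X)
    (hXi : Integrable (fun ω => X (Preorder.frestrictLe (π := fun _ => E) t ω))
      (chainMeasure κ hn d))
    {ψ : E → ℝ} (hψ : Measurable ψ) {K : ℝ} (hψK : ∀ z, |ψ z| ≤ K) :
    ∫ ω, X (Preorder.frestrictLe (π := fun _ => E) t ω) * ψ (ω (t + 1)) ∂chainMeasure κ hn d
      = ∫ ω, X (Preorder.frestrictLe (π := fun _ => E) t ω) * (∫ z, ψ z ∂κ (nxt (ω t)))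
        ∂chainMeasure κ hn d := by
  set P := chainMeasure κ hn d
  have : IsProbabilityMeasure (P.map (Preorder.frestrictLe (π := fun _ => E) t)) :=
    Measure.isProbabilityMeasure_map (by fun_prop)
  set η : Kernel ((i : Finset.Iic t) → E) E :=
    κ.comap (fun h : (i : Finset.Iic t) → E => nxt (h ⟨t, by simp⟩)) (by fun_prop)
  have hF : Measurable fun x : ((i : Finset.Iic t) → E) × E => X x.1 * ψ x.2 := by fun_prop
  have hint : Integrable (fun ω => X (Preorder.frestrictLe (π := fun _ => E) t ω) * ψ (ω (t + 1)))
      P := hXi.mul_bdd (hψ.comp (measurable_pi_apply _)).aestronglyMeasurable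
        (ae_of_all _ fun ω => hψK _)
  have hjoint := chainMeasure_map_frestrictLe_succ (κ := κ) hn d t
  have hint' : Integrable (fun x : ((i : Finset.Iic t) → E) × E => X x.1 * ψ x.2)
      (P.map (Preorder.frestrictLe (π := fun _ => E) t) ⊗ₘ η) := by
    rw [← hjoint]
    exact (integrable_map_measure hF.aestronglyMeasurable (by fun_prop)).2 hint
  have h1 := Measure.integral_compProd hint'
  rw [← hjoint, integral_map (by fun_prop) hF.aestronglyMeasurable] at h1
  rw [h1]
  simp_rw [integral_const_mul]
  have hlast : Measurable fun h : (i : Finset.Iic t) → E => nxt (h ⟨t, by simp⟩) := by fun_prop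
  rw [integral_map (by fun_prop)]
  · rfl
  · exact (hX.mul ((measurable_of_finite fun s => ∫ z, ψ z ∂κ s).comp hlast)).aestronglyMeasurable

end Chain

/-! ### Transition operators -/

section Transition

set_option linter.unusedSectionVars false

variable {S E : Type*} [Fintype S] [MeasurableSpace S] [MeasurableSingletonClass S]
  [MeasurableSpace E]

/-- The transition operator weighted by `ρ`, which maps `f` to `s ↦ ∫ z, ρ z * f (nxt z) ∂κ s` (for
integrable `ρ`). The weight `1` gives the transition operator of the chain of states. -/
noncomputable def weightedTransition (κ : Kernel S E) (nxt : E → S) (ρ : E → ℝ) :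
    (S → ℝ) →L[ℝ] (S → ℝ) :=
  ContinuousLinearMap.pi fun s =>
    ∑ s', (∫ z in nxt ⁻¹' {s'}, ρ z ∂κ s) • ContinuousLinearMap.proj s'

variable {κ : Kernel S E} [IsMarkovKernel κ] {nxt : E → S}

lemma weightedTransition_apply (hn : Measurable nxt) {ρ : E → ℝ} {s : S} (hρ : Integrable ρ (κ s)) (f : S → ℝ) :
    weightedTransition κ nxt ρ f s = ∫ z, ρ z * f (nxt z) ∂κ s := by
  have h1 : ∀ z, ρ z * f (nxt z) = ∑ s', (nxt ⁻¹' {s'}).indicator (fun z => ρ z * f s') z := by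
    intro z
    rw [Finset.sum_eq_single (nxt z)]
    · rw [Set.indicator_of_mem (by simp)]
    · intro s' _ hs'
      rw [Set.indicator_of_notMem (by simpa using hs'.symm)]
    · simp
  have hm : ∀ s', MeasurableSet (nxt ⁻¹' {s'}) := fun s' => hn (measurableSet_singleton s')
  simp_rw [h1]
  rw [integral_finsetSum _ fun s' _ => (hρ.mul_const _).indicator (hm s')]
  simp_rw [integral_indicator (hm _), integral_mul_const]
  simp [weightedTransition]

lemma weightedTransition_one_apply (hn : Measurable nxt) (f : S → ℝ) (s : S) :
    weightedTransition κ nxt 1 f s = ∫ z, f (nxt z) ∂κ s := by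
  rw [weightedTransition_apply hn (ρ := 1) (integrable_const (1 : ℝ)) f]
  simp

lemma integrable_of_abs_le {φ : E → ℝ} (hφ : Measurable φ) {K : ℝ} (hK : ∀ z, |φ z| ≤ K) (s : S) :
    Integrable φ (κ s) :=
  Integrable.of_bound hφ.aestronglyMeasurable K (ae_of_all _ hK)

lemma integrable_comp_next (hn : Measurable nxt) (f : S → ℝ) (s : S) : Integrable (fun z => f (nxt z)) (κ s) :=
  Integrable.of_finite.comp_measurable (f := nxt) (g := f) hn

lemma exists_abs_le_of_finite (f : S → ℝ) : ∃ K, ∀ s, |f s| ≤ K :=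
  ⟨‖f‖, fun s => norm_le_pi_norm f s⟩


/-- Expectations of a function of one record. -/
lemma integral_chainMeasure (hn : Measurable nxt) (d : Measure S)
    [IsProbabilityMeasure d] {φ : E → ℝ} (hφm : StronglyMeasurable φ)
    (hφ : ∀ s, Integrable φ (κ s)) (t : ℕ) :
    ∫ ω, φ (ω t) ∂chainMeasure κ hn d
      = ∫ s, (weightedTransition κ nxt 1 ^ t) (fun s => ∫ z, φ z ∂κ s) s ∂d := by
  induction t generalizing φ with
  | zero => exact integral_chainMeasure_zero hn d hφm hφ
  | succ t ih =>
    rw [integral_chainMeasure_succ hn d hφm hφ, pow_succ, ih (φ := fun z => ∫ z', φ z' ∂κ (nxt z))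
      ((measurable_of_finite fun s => ∫ z', φ z' ∂κ s).comp hn).stronglyMeasurable
      (integrable_comp_next hn fun s => ∫ z', φ z' ∂κ s)]
    congr 1
    ext s
    rw [mul_apply_eq_comp]
    exact congrArg (fun g => (weightedTransition κ nxt 1 ^ t) g s)
      (funext fun s => (weightedTransition_one_apply (κ := κ) hn
        (fun s => ∫ z', φ z' ∂κ s) s).symm)

lemma integral_mul_chainMeasure_next (hn : Measurable nxt) (d : Measure S)
    [IsProbabilityMeasure d] {φ ψ : E → ℝ} (hφm : Measurable φ)
    (hφ : ∀ s, Integrable φ (κ s)) (hψ : Measurable ψ) {K : ℝ} (hψK : ∀ z, |ψ z| ≤ K) (t k : ℕ) :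
    ∫ ω, φ (ω t) * ψ (ω (t + k + 1)) ∂chainMeasure κ hn d
      = ∫ ω, φ (ω t) * (weightedTransition κ nxt 1 ^ k) (fun s => ∫ z, ψ z ∂κ s) (nxt (ω t))
        ∂chainMeasure κ hn d := by
  induction k generalizing ψ K with
  | zero =>
    exact integral_mul_chainMeasure_succ hn d (t := t) (X := fun h => φ (h ⟨t, by simp⟩))
      (by fun_prop) (integrable_chainMeasure hn d hφm.stronglyMeasurable hφ t) hψ hψK
  | succ k ih =>
    have h1 := integral_mul_chainMeasure_succ (κ := κ) hn d (t := t + k + 1)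
      (X := fun h => φ (h ⟨t, by simp; omega⟩))
      (by fun_prop) (integrable_chainMeasure hn d hφm.stronglyMeasurable hφ t) hψ hψK
    obtain ⟨K', hK'⟩ := exists_abs_le_of_finite fun s => ∫ z, ψ z ∂κ s
    have h2 := ih (ψ := fun z => ∫ z', ψ z' ∂κ (nxt z))
      ((measurable_of_finite fun s => ∫ z', ψ z' ∂κ s).comp hn) (fun z => hK' (nxt z))
    refine h1.trans (h2.trans ?_)
    have h3 : (fun s => ∫ z, ∫ z', ψ z' ∂κ (nxt z) ∂κ s)
        = weightedTransition κ nxt 1 (fun s => ∫ z, ψ z ∂κ s) := by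
      ext s
      rw [weightedTransition_one_apply hn]
    rw [h3, pow_succ]
    rfl

/-- Expectations of a product of functions of two records. -/
lemma integral_mul_chainMeasure (hn : Measurable nxt) (d : Measure S)
    [IsProbabilityMeasure d] {φ ψ : E → ℝ} (hφm : Measurable φ)
    (hφ : ∀ s, Integrable φ (κ s)) (hψ : Measurable ψ) {K : ℝ} (hψK : ∀ z, |ψ z| ≤ K) (t k : ℕ) :
    ∫ ω, φ (ω t) * ψ (ω (t + k + 1)) ∂chainMeasure κ hn d
      = ∫ s, (weightedTransition κ nxt 1 ^ t) (weightedTransition κ nxt φ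
        ((weightedTransition κ nxt 1 ^ k) fun s => ∫ z, ψ z ∂κ s)) s ∂d := by
  rw [integral_mul_chainMeasure_next hn d hφm hφ hψ hψK]
  set f := (weightedTransition κ nxt 1 ^ k) fun s => ∫ z, ψ z ∂κ s
  obtain ⟨K', hK'⟩ := exists_abs_le_of_finite f
  have hfm : Measurable fun z => f (nxt z) := (measurable_of_finite f).comp hn
  rw [integral_chainMeasure hn d (φ := fun z => φ z * f (nxt z))
    (hφm.mul hfm).stronglyMeasurable
    (fun s => (hφ s).mul_bdd hfm.aestronglyMeasurable (ae_of_all _ fun z => hK' _))]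
  have h : (fun s => ∫ z, φ z * f (nxt z) ∂κ s) = weightedTransition κ nxt φ f := by
    ext s
    rw [weightedTransition_apply hn (hφ s)]
  rw [h]

end Transition

/-! ### Potentials of an absorbed chain -/

section Potential

set_option linter.unusedSectionVars false

variable {S E : Type*} [Fintype S] [MeasurableSpace S] [MeasurableSingletonClass S]
  [MeasurableSpace E]

/-- The set `Z` of states is never left, and the discounted probabilities that the chain has not yet
reached `Z` at time `k` are at most `a k`, with `a` summable. This covers both a discount factor
below one, with `Z = ∅`, and undiscounted episodic tasks. -/
structure IsSummablyAbsorbed (κ : Kernel S E) (nxt : E → S) (γ : ℝ) (Z : Set S) (a : ℕ → ℝ) :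
    Prop where
  γ_nonneg : 0 ≤ γ
  γ_le_one : γ ≤ 1
  closed : ∀ s ∈ Z, ∀ᵐ z ∂κ s, nxt z ∈ Z
  a_nonneg : ∀ k, 0 ≤ a k
  summable : Summable a
  pow_le : ∀ k s, γ ^ k * (weightedTransition κ nxt 1 ^ k) (Zᶜ.indicator 1) s
    ≤ a k * Zᶜ.indicator 1 s

/-- The discounted sum of the expected values of `g` along the chain of states. -/
noncomputable def potential (κ : Kernel S E) (nxt : E → S) (γ : ℝ) (g : S → ℝ) : S → ℝ :=
  ∑' k, γ ^ k • (weightedTransition κ nxt 1 ^ k) g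

/-- Expectation as a continuous linear functional on functions of the state. -/
noncomputable def expectationCLM (d : Measure S) [IsProbabilityMeasure d] : (S → ℝ) →L[ℝ] ℝ :=
  LinearMap.toContinuousLinearMap
    { toFun := fun f => ∫ s, f s ∂d
      map_add' := fun _ _ => integral_add Integrable.of_finite Integrable.of_finite
      map_smul' := fun c f => integral_const_mul c f }

lemma expectationCLM_apply (d : Measure S) [IsProbabilityMeasure d] (f : S → ℝ) :
    expectationCLM d f = ∫ s, f s ∂d := rfl

lemma abs_expectationCLM_le (d : Measure S) [IsProbabilityMeasure d] {f : S → ℝ} {c : ℝ}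
    (hf : ∀ s, |f s| ≤ c) : |expectationCLM d f| ≤ c := by
  have := norm_integral_le_of_norm_le_const (μ := d) (f := f) (C := c) (ae_of_all _ hf)
  simpa [expectationCLM_apply] using this

variable {κ : Kernel S E} [IsMarkovKernel κ] {nxt : E → S}

lemma weightedTransition_one_mono (hn : Measurable nxt) {f g : S → ℝ} (h : f ≤ g) :
    weightedTransition κ nxt 1 f ≤ weightedTransition κ nxt 1 g := by
  intro s
  rw [weightedTransition_one_apply hn, weightedTransition_one_apply hn]
  exact integral_mono (integrable_comp_next hn f s) (integrable_comp_next hn g s) fun z => h _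

lemma weightedTransition_one_pow_mono (hn : Measurable nxt) {f g : S → ℝ} (h : f ≤ g) (k : ℕ) :
    (weightedTransition κ nxt 1 ^ k) f ≤ (weightedTransition κ nxt 1 ^ k) g := by
  induction k with
  | zero => exact h
  | succ k ih =>
    rw [pow_succ']
    exact weightedTransition_one_mono hn ih

lemma indicator_compl_nonneg (Z : Set S) (s : S) : (0 : ℝ) ≤ Zᶜ.indicator 1 s :=
  Set.indicator_nonneg (fun _ _ => zero_le_one) s

lemma indicator_compl_le_one (Z : Set S) (s : S) : Zᶜ.indicator 1 s ≤ (1 : ℝ) :=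
  Set.indicator_le' (fun _ _ => le_rfl) (fun _ _ => zero_le_one) s

/-- Absorbing sets are not left, so weighted transitions preserve vanishing on `Z`. -/
lemma abs_weightedTransition_le (hn : Measurable nxt) {Z : Set S}
    (hZ : ∀ s ∈ Z, ∀ᵐ z ∂κ s, nxt z ∈ Z)
    {φ : E → ℝ} (hφ : ∀ s, Integrable φ (κ s)) {m : ℝ} (hm : ∀ s, ∫ z, |φ z| ∂κ s ≤ m)
    {f : S → ℝ} {c : ℝ} (hc : 0 ≤ c) (hf : ∀ s, |f s| ≤ c * Zᶜ.indicator 1 s) (s : S) :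
    |weightedTransition κ nxt φ f s| ≤ c * m * Zᶜ.indicator 1 s := by
  rw [weightedTransition_apply hn (hφ s)]
  by_cases hs : s ∈ Z
  · have : ∫ z, φ z * f (nxt z) ∂κ s = 0 := by
      refine integral_eq_zero_of_ae ?_
      filter_upwards [hZ s hs] with z hz
      have h0 : f (nxt z) = 0 := by
        have := hf (nxt z)
        simpa [hz] using this
      simp [h0]
    simp [this, hs]
  · have hind : Zᶜ.indicator (1 : S → ℝ) s = 1 := by simp [hs]
    rw [hind, mul_one]
    have hb : ∀ z, |f (nxt z)| ≤ c := fun z => (hf _).trans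
      (mul_le_of_le_one_right hc (indicator_compl_le_one Z _))
    calc |∫ z, φ z * f (nxt z) ∂κ s| ≤ ∫ z, |φ z * f (nxt z)| ∂κ s :=
          abs_integral_le_integral_abs
      _ ≤ ∫ z, c * |φ z| ∂κ s := by
          refine integral_mono_of_nonneg (ae_of_all _ fun z => abs_nonneg _)
            ((hφ s).abs.const_mul c) (ae_of_all _ fun z => ?_)
          simp only [abs_mul]
          rw [mul_comm]
          gcongr
          exact hb z
      _ ≤ c * m := by
          rw [integral_const_mul]
          gcongr
          exact hm s

/-- Means of products with a bounded reward that is zero from `Z` on. -/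
lemma abs_integral_mul_reward_le {Z : Set S} {rew : E → ℝ} {K : ℝ} (hK0 : 0 ≤ K)
    (hK : ∀ z, |rew z| ≤ K)
    (hZr : ∀ s ∈ Z, ∀ᵐ z ∂κ s, rew z = 0)
    {φ : E → ℝ} (hφ : ∀ s, Integrable φ (κ s)) {m : ℝ} (hm : ∀ s, ∫ z, |φ z| ∂κ s ≤ m) (s : S) :
    |∫ z, φ z * rew z ∂κ s| ≤ K * m * Zᶜ.indicator 1 s := by
  by_cases hs : s ∈ Z
  · have : ∫ z, φ z * rew z ∂κ s = 0 := by
      refine integral_eq_zero_of_ae ?_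
      filter_upwards [hZr s hs] with z hz
      simp [hz]
    simp [this, hs]
  · have hind : Zᶜ.indicator (1 : S → ℝ) s = 1 := by simp [hs]
    rw [hind, mul_one]
    calc |∫ z, φ z * rew z ∂κ s| ≤ ∫ z, |φ z * rew z| ∂κ s := abs_integral_le_integral_abs
      _ ≤ ∫ z, K * |φ z| ∂κ s := by
          refine integral_mono_of_nonneg (ae_of_all _ fun z => abs_nonneg _)
            ((hφ s).abs.const_mul K) (ae_of_all _ fun z => ?_)
          simp only [abs_mul]
          rw [mul_comm]
          gcongr
          exact hK z
      _ ≤ K * m := by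
          rw [integral_const_mul]
          gcongr
          exact hm s

namespace IsSummablyAbsorbed

variable {γ : ℝ} {Z : Set S} {a : ℕ → ℝ}

lemma abs_pow_le (H : IsSummablyAbsorbed κ nxt γ Z a) (hn : Measurable nxt) {f : S → ℝ} {c : ℝ}
    (hc : 0 ≤ c) (hf : ∀ s, |f s| ≤ c * Zᶜ.indicator 1 s) (k : ℕ) (s : S) :
    |(γ ^ k • (weightedTransition κ nxt 1 ^ k) f) s| ≤ c * a k * Zᶜ.indicator 1 s := by
  have h1 : (weightedTransition κ nxt 1 ^ k) f ≤
      (weightedTransition κ nxt 1 ^ k) (c • Zᶜ.indicator 1) :=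
    weightedTransition_one_pow_mono hn (fun s => (le_abs_self _).trans (hf s)) k
  have h2 : (weightedTransition κ nxt 1 ^ k) (-(c • Zᶜ.indicator 1)) ≤
      (weightedTransition κ nxt 1 ^ k) f :=
    weightedTransition_one_pow_mono hn (fun s => (abs_le.1 (hf s)).1) k
  have h1s := h1 s
  have h2s := h2 s
  rw [map_smul] at h1s
  rw [map_neg, map_smul] at h2s
  simp only [Pi.smul_apply, Pi.neg_apply, smul_eq_mul] at h1s h2s ⊢
  have hγ := pow_nonneg H.γ_nonneg k
  rw [abs_mul, abs_of_nonneg hγ]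
  calc γ ^ k * |(weightedTransition κ nxt 1 ^ k) f s|
      ≤ γ ^ k * (c * (weightedTransition κ nxt 1 ^ k) (Zᶜ.indicator 1) s) := by
        gcongr
        exact abs_le.2 ⟨h2s, h1s⟩
    _ = c * (γ ^ k * (weightedTransition κ nxt 1 ^ k) (Zᶜ.indicator 1) s) := by ring
    _ ≤ c * (a k * Zᶜ.indicator 1 s) := mul_le_mul_of_nonneg_left (H.pow_le k s) hc
    _ = _ := by ring

lemma norm_pow_le (H : IsSummablyAbsorbed κ nxt γ Z a) (hn : Measurable nxt) {f : S → ℝ} {c : ℝ}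
    (hc : 0 ≤ c) (hf : ∀ s, |f s| ≤ c * Zᶜ.indicator 1 s) (k : ℕ) :
    ‖γ ^ k • (weightedTransition κ nxt 1 ^ k) f‖ ≤ c * a k := by
  have hca := mul_nonneg hc (H.a_nonneg k)
  refine (pi_norm_le_iff_of_nonneg hca).2 fun s => ?_
  exact (H.abs_pow_le hn hc hf k s).trans
    (mul_le_of_le_one_right hca (indicator_compl_le_one Z s))

lemma hasSum_potential (H : IsSummablyAbsorbed κ nxt γ Z a) (hn : Measurable nxt) {f : S → ℝ}
    {c : ℝ} (hc : 0 ≤ c) (hf : ∀ s, |f s| ≤ c * Zᶜ.indicator 1 s) :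
    HasSum (fun k => γ ^ k • (weightedTransition κ nxt 1 ^ k) f) (potential κ nxt γ f) :=
  (Summable.of_norm_bounded (H.summable.mul_left c) fun k => H.norm_pow_le hn hc hf k).hasSum

lemma abs_potential_le (H : IsSummablyAbsorbed κ nxt γ Z a) (hn : Measurable nxt) {f : S → ℝ}
    {c : ℝ} (hc : 0 ≤ c) (hf : ∀ s, |f s| ≤ c * Zᶜ.indicator 1 s) (s : S) :
    |potential κ nxt γ f s| ≤ c * (∑' k, a k) * Zᶜ.indicator 1 s := by
  have h1 : HasSum (fun k => (γ ^ k • (weightedTransition κ nxt 1 ^ k) f) s)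
      (potential κ nxt γ f s) := Pi.hasSum.1 (H.hasSum_potential hn hc hf) s
  have h2 : HasSum (fun k => c * a k * Zᶜ.indicator (1 : S → ℝ) s)
      (c * (∑' k, a k) * Zᶜ.indicator 1 s) := (H.summable.hasSum.mul_left c).mul_right _
  have h3 := tsum_of_norm_bounded
    (f := fun k => (γ ^ k • (weightedTransition κ nxt 1 ^ k) f) s) h2 (fun k => H.abs_pow_le hn hc hf k s)
  rwa [h1.tsum_eq] at h3

/-- The potential solves the Poisson equation. -/
lemma potential_eq (H : IsSummablyAbsorbed κ nxt γ Z a) (hn : Measurable nxt) {f : S → ℝ}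
    {c : ℝ} (hc : 0 ≤ c) (hf : ∀ s, |f s| ≤ c * Zᶜ.indicator 1 s) :
    potential κ nxt γ f = f + γ • weightedTransition κ nxt 1 (potential κ nxt γ f) := by
  have h1 := H.hasSum_potential hn hc hf
  have h2 := ((weightedTransition κ nxt 1).hasSum h1).const_smul γ
  have h3 := (hasSum_nat_add_iff' 1).2 h1
  rw [Finset.sum_range_one, pow_zero, pow_zero, one_smul] at h3
  have h4 : (fun k => γ • (weightedTransition κ nxt 1)
        (γ ^ k • (weightedTransition κ nxt 1 ^ k) f))
      = fun k => γ ^ (k + 1) • (weightedTransition κ nxt 1 ^ (k + 1)) f := by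
    ext1 k
    rw [map_smul, smul_smul, ← pow_succ', pow_succ' (weightedTransition κ nxt 1)]
    rfl
  rw [h4] at h2
  have h5 := h2.unique h3
  rw [h5, one_apply_eq_self]
  abel

/-- The transition operator killed on `Z` acts as the transition operator on functions that vanish
on `Z`. -/
lemma killed_apply (hn : Measurable nxt) {f : S → ℝ} (hf : ∀ s ∈ Z, f s = 0) :
    weightedTransition κ nxt (fun z => Zᶜ.indicator 1 (nxt z)) f
      = weightedTransition κ nxt 1 f := by
  ext s
  rw [weightedTransition_apply hn (integrable_comp_next hn _ s), weightedTransition_one_apply hn]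
  congr 1
  ext z
  by_cases hz : nxt z ∈ Z
  · simp [hz, hf _ hz]
  · simp [hz]

lemma abs_killed_le (H : IsSummablyAbsorbed κ nxt γ Z a) (hn : Measurable nxt) (f : S → ℝ) (s : S) :
    |weightedTransition κ nxt (fun z => Zᶜ.indicator 1 (nxt z)) f s|
      ≤ ‖f‖ * Zᶜ.indicator 1 s := by
  rw [weightedTransition_apply hn (integrable_comp_next hn _ s)]
  have h1 : ∀ s, |Zᶜ.indicator 1 s * f s| ≤ ‖f‖ * Zᶜ.indicator 1 s := by
    intro s
    rw [abs_mul, abs_of_nonneg (indicator_compl_nonneg Z s), mul_comm]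
    exact mul_le_mul_of_nonneg_right (norm_le_pi_norm f s) (indicator_compl_nonneg Z s)
  have h2 := abs_weightedTransition_le hn H.closed (φ := 1) (m := 1)
    (f := fun s => Zᶜ.indicator 1 s * f s)
    (fun s => integrable_const (1 : ℝ)) (fun s => by simp) (norm_nonneg f) h1 s
  rw [weightedTransition_one_apply hn, mul_one] at h2
  exact h2

/-- The homogeneous killed Poisson equation has only the zero solution. -/
lemma eq_zero_of_eq_killed (H : IsSummablyAbsorbed κ nxt γ Z a) (hn : Measurable nxt) {x : S → ℝ}
    (hx : x = γ • weightedTransition κ nxt (fun z => Zᶜ.indicator 1 (nxt z)) x) : x = 0 := by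
  have hdom : ∀ s, |x s| ≤ ‖x‖ * Zᶜ.indicator 1 s := by
    intro s
    conv_lhs => rw [hx]
    rw [Pi.smul_apply, smul_eq_mul, abs_mul, abs_of_nonneg H.γ_nonneg]
    exact (mul_le_of_le_one_left (abs_nonneg _) H.γ_le_one).trans (H.abs_killed_le hn x s)
  have hzero : ∀ s ∈ Z, x s = 0 := by
    intro s hs
    simpa [hs] using hdom s
  rw [killed_apply hn hzero] at hx
  have hpow : ∀ k, x = γ ^ k • (weightedTransition κ nxt 1 ^ k) x := by
    intro k
    induction k with
    | zero => simp
    | succ k ih =>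
      rw [pow_succ, pow_succ, mul_smul]
      change x = γ ^ k • γ • (weightedTransition κ nxt 1 ^ k) (weightedTransition κ nxt 1 x)
      rw [← map_smul, ← hx]
      exact ih
  have hlim : Tendsto (fun k => ‖x‖ * a k) atTop (𝓝 (‖x‖ * 0)) :=
    H.summable.tendsto_atTop_zero.const_mul _
  rw [mul_zero] at hlim
  have hle : ‖x‖ ≤ 0 := ge_of_tendsto' hlim fun k => by
    have := H.norm_pow_le hn (norm_nonneg x) hdom k
    rwa [← hpow k] at this
  exact norm_le_zero_iff.1 hle

lemma isUnit_one_sub_killed (H : IsSummablyAbsorbed κ nxt γ Z a) (hn : Measurable nxt) :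
    IsUnit (1 - γ • weightedTransition κ nxt (fun z => Zᶜ.indicator 1 (nxt z))) := by
  set A := 1 - γ • weightedTransition κ nxt (fun z => Zᶜ.indicator 1 (nxt z)) with hA
  have hinj : Function.Injective A := by
    refine (injective_iff_map_eq_zero A).2 fun x hx => H.eq_zero_of_eq_killed hn ?_
    exact sub_eq_zero.1 hx
  rw [ContinuousLinearMap.isUnit_iff_bijective]
  exact ⟨hinj, LinearMap.injective_iff_surjective (f := (A : (S → ℝ) →ₗ[ℝ] (S → ℝ))).1 hinj⟩

/-- The potential is the only solution of the killed Poisson equation. -/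
lemma eq_potential (H : IsSummablyAbsorbed κ nxt γ Z a) (hn : Measurable nxt) {f x : S → ℝ}
    {c : ℝ} (hc : 0 ≤ c) (hf : ∀ s, |f s| ≤ c * Zᶜ.indicator 1 s)
    (hx : x = f + γ • weightedTransition κ nxt (fun z => Zᶜ.indicator 1 (nxt z)) x) :
    x = potential κ nxt γ f := by
  have h1 := H.potential_eq hn hc hf
  have hzero : ∀ s ∈ Z, potential κ nxt γ f s = 0 := by
    intro s hs
    simpa [hs] using H.abs_potential_le hn hc hf s
  rw [← killed_apply hn hzero] at h1
  refine sub_eq_zero.1 (H.eq_zero_of_eq_killed hn ?_)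
  rw [map_sub, smul_sub]
  nth_rewrite 1 [hx, h1]
  abel

end IsSummablyAbsorbed

end Potential

/-! ### Expected returns and expected products of returns and scores -/

section Returns

set_option linter.unusedSectionVars false

variable {S E : Type*} [Fintype S] [MeasurableSpace S] [MeasurableSingletonClass S]
  [MeasurableSpace E] {κ : Kernel S E} [IsMarkovKernel κ] {nxt : E → S} {γ : ℝ} {Z : Set S}
  {a : ℕ → ℝ}

namespace IsSummablyAbsorbed

lemma abs_integral_reward_le {rew : E → ℝ} {K : ℝ} (hK0 : 0 ≤ K) (hK : ∀ z, |rew z| ≤ K)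
    (hZr : ∀ s ∈ Z, ∀ᵐ z ∂κ s, rew z = 0) (s : S) :
    |∫ z, rew z ∂κ s| ≤ K * Zᶜ.indicator 1 s := by
  have := abs_integral_mul_reward_le (κ := κ) hK0 hK hZr (φ := 1) (m := 1)
    (fun s => integrable_const (1 : ℝ)) (fun s => by simp) s
  simpa using this

/-- The expected return is the expectation of the potential of the expected rewards. -/
theorem integral_tsum_reward (H : IsSummablyAbsorbed κ nxt γ Z a) (hn : Measurable nxt)
    (d : Measure S) [IsProbabilityMeasure d] {rew : E → ℝ} (hrew : Measurable rew) {K : ℝ}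
    (hK0 : 0 ≤ K) (hK : ∀ z, |rew z| ≤ K) (hZr : ∀ s ∈ Z, ∀ᵐ z ∂κ s, rew z = 0) :
    ∫ ω, ∑' k, γ ^ k * rew (ω k) ∂chainMeasure κ hn d
      = ∫ s, potential κ nxt γ (fun s => ∫ z, rew z ∂κ s) s ∂d := by
  have hdom := abs_integral_reward_le (κ := κ) hK0 hK hZr
  have hint : ∀ k, ∀ f : E → ℝ, Measurable f → (∀ z, |f z| ≤ K) →
      ∫ ω, γ ^ k * f (ω k) ∂chainMeasure κ hn d
        = expectationCLM d (γ ^ k • (weightedTransition κ nxt 1 ^ k) fun s => ∫ z, f z ∂κ s) := by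
    intro k f hf hfK
    rw [integral_const_mul, integral_chainMeasure hn d hf.stronglyMeasurable
      (integrable_of_abs_le hf hfK), map_smul]
    rfl
  have habs : ∀ s, |∫ z, |rew z| ∂κ s| ≤ K * Zᶜ.indicator 1 s :=
    abs_integral_reward_le hK0 (fun z => by simpa using hK z)
      (fun s hs => (hZr s hs).mono fun z hz => by simp [hz])
  have h1 := hasSum_integral_of_summable_integral_norm (μ := chainMeasure κ hn d)
    (F := fun k ω => γ ^ k * rew (ω k))
    (fun k => (integrable_chainMeasure hn d hrew.stronglyMeasurable
      (integrable_of_abs_le hrew hK) k).const_mul _) (by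
      refine Summable.of_nonneg_of_le (fun k => integral_nonneg fun ω => norm_nonneg _)
        (fun k => ?_) (H.summable.mul_left K)
      have : ∀ ω : ℕ → E, ‖γ ^ k * rew (ω k)‖ = γ ^ k * |rew (ω k)| := fun ω => by
        rw [norm_mul, Real.norm_of_nonneg (pow_nonneg H.γ_nonneg k), Real.norm_eq_abs]
      simp_rw [this]
      rw [hint k (fun z => |rew z|) hrew.abs (fun z => by simpa using hK z)]
      exact (le_abs_self _).trans (abs_expectationCLM_le d fun s =>
        (norm_le_pi_norm _ s).trans (H.norm_pow_le hn hK0 habs k)))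
  have h2 := (expectationCLM d).hasSum (H.hasSum_potential hn hK0 hdom)
  simp_rw [hint _ rew hrew hK] at h1
  exact h1.unique h2

/-- Expectations of products of rewards and a function `φ` of the current record. -/
lemma hasSum_integral_mul_reward (H : IsSummablyAbsorbed κ nxt γ Z a) (hn : Measurable nxt)
    (d : Measure S) [IsProbabilityMeasure d] {rew : E → ℝ} (hrew : Measurable rew) {K : ℝ}
    (hK0 : 0 ≤ K) (hK : ∀ z, |rew z| ≤ K) (hZr : ∀ s ∈ Z, ∀ᵐ z ∂κ s, rew z = 0)
    {φ : E → ℝ} (hφm : Measurable φ) (hφ : ∀ s, Integrable φ (κ s)) (t : ℕ) :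
    HasSum (fun k => ∫ ω, γ ^ t * (γ ^ k * (φ (ω t) * rew (ω (t + k)))) ∂chainMeasure κ hn d)
      (expectationCLM d (γ ^ t • (weightedTransition κ nxt 1 ^ t)
        ((fun s => ∫ z, φ z * rew z ∂κ s) + γ • weightedTransition κ nxt φ
          (potential κ nxt γ fun s => ∫ z, rew z ∂κ s)))) := by
  have hdom := abs_integral_reward_le (κ := κ) hK0 hK hZr
  refine (hasSum_nat_add_iff' 1).1 ?_
  rw [Finset.sum_range_one]
  have h0 : ∫ ω, γ ^ t * (γ ^ 0 * (φ (ω t) * rew (ω (t + 0)))) ∂chainMeasure κ hn d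
      = expectationCLM d (γ ^ t • (weightedTransition κ nxt 1 ^ t)
        (fun s => ∫ z, φ z * rew z ∂κ s)) := by
    simp only [pow_zero, one_mul, add_zero]
    rw [integral_const_mul, map_smul, integral_chainMeasure hn d (φ := fun z => φ z * rew z)
      (hφm.mul hrew).stronglyMeasurable
      (fun s => (hφ s).mul_bdd hrew.aestronglyMeasurable (ae_of_all _ hK))]
    rfl
  have h1 : ∀ k, ∫ ω, γ ^ t * (γ ^ (k + 1) * (φ (ω t) * rew (ω (t + (k + 1)))))
        ∂chainMeasure κ hn d
      = expectationCLM d (γ ^ t • (weightedTransition κ nxt 1 ^ t) (γ •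
        weightedTransition κ nxt φ (γ ^ k • (weightedTransition κ nxt 1 ^ k)
          fun s => ∫ z, rew z ∂κ s))) := by
    intro k
    rw [integral_const_mul, integral_const_mul]
    have := integral_mul_chainMeasure hn d hφm hφ hrew hK t k
    rw [← add_assoc, this]
    simp only [map_smul, smul_eq_mul, expectationCLM_apply]
    ring
  simp_rw [h1]
  rw [h0, map_add, smul_add, map_add, add_sub_cancel_left]
  have h2 := (weightedTransition κ nxt φ).hasSum (H.hasSum_potential hn hK0 hdom)
  exact (expectationCLM d).hasSum (((weightedTransition κ nxt 1 ^ t).hasSum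
    (h2.const_smul γ)).const_smul (γ ^ t))

/-- Expectations of products of absolute rewards and a nonnegative function of the current record
are summable. -/
lemma summable_integral_mul_abs_reward (H : IsSummablyAbsorbed κ nxt γ Z a) (hn : Measurable nxt)
    (d : Measure S) [IsProbabilityMeasure d] {rew : E → ℝ} (hrew : Measurable rew) {K : ℝ}
    (hK0 : 0 ≤ K) (hK : ∀ z, |rew z| ≤ K) (hZr : ∀ s ∈ Z, ∀ᵐ z ∂κ s, rew z = 0)
    {φ : E → ℝ} (hφm : Measurable φ) (hφ : ∀ s, Integrable φ (κ s)) (hφ0 : ∀ z, 0 ≤ φ z) :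
    Summable fun p : ℕ × ℕ =>
      ∫ ω, γ ^ p.1 * (γ ^ p.2 * (φ (ω p.1) * |rew (ω (p.1 + p.2))|)) ∂chainMeasure κ hn d := by
  have hnn : ∀ t k (ω : ℕ → E), 0 ≤ γ ^ t * (γ ^ k * (φ (ω t) * |rew (ω (t + k))|)) := by
    intro t k ω
    have := hφ0 (ω t)
    have := H.γ_nonneg
    positivity
  have hrew' : Measurable fun z => |rew z| := hrew.abs
  have hK' : ∀ z, |(|rew z|)| ≤ K := fun z => by simpa using hK z
  have hZr' : ∀ s ∈ Z, ∀ᵐ z ∂κ s, |rew z| = 0 := fun s hs =>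
    (hZr s hs).mono fun z hz => by simp [hz]
  have hsum := fun t => H.hasSum_integral_mul_reward hn d hrew' hK0 hK' hZr' hφm hφ t
  rw [summable_prod_of_nonneg fun p => integral_nonneg (hnn p.1 p.2)]
  refine ⟨fun t => (hsum t).summable, ?_⟩
  simp_rw [fun t => (hsum t).tsum_eq]
  -- the function of the state has an envelope that vanishes on `Z`
  set g := (fun s => ∫ z, φ z * |rew z| ∂κ s) + γ • weightedTransition κ nxt φ
          (potential κ nxt γ fun s => ∫ z, |rew z| ∂κ s) with hg
  obtain ⟨m, hm⟩ : ∃ m, ∀ s, ∫ z, |φ z| ∂κ s ≤ m := by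
    obtain ⟨m, hm⟩ := exists_abs_le_of_finite fun s => ∫ z, |φ z| ∂κ s
    exact ⟨m, fun s => (le_abs_self _).trans (hm s)⟩
  by_cases hS : Nonempty S
  swap
  · have : IsEmpty S := not_nonempty_iff.1 hS
    have : ∀ f : S → ℝ, f = 0 := fun f => Subsingleton.elim _ _
    simp [this (_ • _)]
  have hm0 : 0 ≤ m := (integral_nonneg fun z => abs_nonneg _).trans (hm hS.some)
  have hsa : 0 ≤ ∑' k, a k := tsum_nonneg H.a_nonneg
  have hdom := abs_integral_reward_le (κ := κ) hK0 hK' hZr'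
  have hg_le : ∀ s, |g s| ≤ (K * m + K * (∑' k, a k) * m) * Zᶜ.indicator 1 s := by
    intro s
    have h1 := abs_integral_mul_reward_le hK0 hK' hZr' hφ hm s
    have h2 := abs_weightedTransition_le hn H.closed hφ hm (mul_nonneg hK0 hsa)
      (H.abs_potential_le hn hK0 hdom) s
    rw [hg, Pi.add_apply, Pi.smul_apply, smul_eq_mul, add_mul]
    refine (abs_add_le _ _).trans (add_le_add h1 ?_)
    rw [abs_mul, abs_of_nonneg H.γ_nonneg]
    exact (mul_le_of_le_one_left (abs_nonneg _) H.γ_le_one).trans h2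
  have hc : 0 ≤ K * m + K * (∑' k, a k) * m := by positivity
  exact ((expectationCLM d).hasSum (H.hasSum_potential hn hc hg_le)).summable

/-- The policy gradient as an expectation over the states: the expected sum of discounted returns
times scores is the expectation of the potential of `s ↦ E[score (reward + γ v(next))]`, where
`v` is the value function. -/
theorem inner_integral_tsum_return_smul {H' : Type*} [NormedAddCommGroup H']
    [InnerProductSpace ℝ H'] [CompleteSpace H']
    (H : IsSummablyAbsorbed κ nxt γ Z a) (hn : Measurable nxt)
    (d : Measure S) [IsProbabilityMeasure d] {rew : E → ℝ} (hrew : Measurable rew) {K : ℝ}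
    (hK0 : 0 ≤ K) (hK : ∀ z, |rew z| ≤ K) (hZr : ∀ s ∈ Z, ∀ᵐ z ∂κ s, rew z = 0)
    {score : E → H'} (hsm : StronglyMeasurable score) (hs : ∀ s, Integrable score (κ s)) (v : H') :
    inner ℝ v (∫ ω, ∑' t, (γ ^ t * ∑' k, γ ^ k * rew (ω (t + k))) • score (ω t)
        ∂chainMeasure κ hn d)
      = ∫ s, potential κ nxt γ ((fun s => ∫ z, inner ℝ v (score z) * rew z ∂κ s)
          + γ • weightedTransition κ nxt (fun z => inner ℝ v (score z))
            (potential κ nxt γ fun s => ∫ z, rew z ∂κ s)) s ∂d := by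
  set P := chainMeasure κ hn d
  set F : ℕ × ℕ → (ℕ → E) → H' := fun p ω =>
    (γ ^ p.1 * (γ ^ p.2 * rew (ω (p.1 + p.2)))) • score (ω p.1) with hF
  have hφi : ∀ s, Integrable (fun z => (inner ℝ v (score z) : ℝ)) (κ s) := fun s =>
    (hs s).const_inner v
  have hφm : Measurable fun z => (inner ℝ v (score z) : ℝ) :=
    (stronglyMeasurable_const.inner hsm).measurable
  have hFint : ∀ p, Integrable (F p) P := by
    intro p
    refine Integrable.bdd_smul (integrable_chainMeasure hn d hsm hs p.1)
      (|γ ^ p.1| * (|γ ^ p.2| * K)) ?_ (ae_of_all _ fun ω => ?_)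
    · exact ((hrew.comp (measurable_pi_apply _)).const_mul _ |>.const_mul _).aestronglyMeasurable
    · rw [Real.norm_eq_abs, abs_mul, abs_mul]
      gcongr
      exact hK _
  have hFnorm : ∀ p ω, ‖F p ω‖
      = γ ^ p.1 * (γ ^ p.2 * (‖score (ω p.1)‖ * |rew (ω (p.1 + p.2))|)) := by
    intro p ω
    simp only [hF]
    rw [norm_smul, norm_mul, norm_mul, Real.norm_of_nonneg (pow_nonneg H.γ_nonneg _),
      Real.norm_of_nonneg (pow_nonneg H.γ_nonneg _), Real.norm_eq_abs]
    ring
  have hFsum : Summable fun p => ∫ ω, ‖F p ω‖ ∂P := by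
    simp_rw [hFnorm]
    exact H.summable_integral_mul_abs_reward hn d hrew hK0 hK hZr
      (φ := fun z => ‖score z‖) hsm.norm.measurable (fun s => (hs s).norm) (fun z => norm_nonneg _)
  have hae : ∀ᵐ ω ∂P, Summable fun p => ‖F p ω‖ :=
    ae_summable_of_summable_integral (fun p ω => norm_nonneg _) (fun p => (hFint p).norm) hFsum
  have hfubini : ∫ ω, ∑' t, (γ ^ t * ∑' k, γ ^ k * rew (ω (t + k))) • score (ω t) ∂P
      = ∫ ω, ∑' p, F p ω ∂P := by
    refine integral_congr_ae ?_
    filter_upwards [hae] with ω hω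
    have hω' : Summable fun p => F p ω := hω.of_norm
    refine Eq.trans ?_ (Summable.tsum_prod (f := fun p => F p ω) hω').symm
    refine tsum_congr fun t => ?_
    by_cases hsc : score (ω t) = 0
    · simp [hF, hsc]
    · have h1 : Summable fun k => |γ ^ t * (γ ^ k * rew (ω (t + k)))| * ‖score (ω t)‖ := by
        have := hω.comp_injective (i := fun k : ℕ => ((t, k) : ℕ × ℕ))
          (fun k k' h => by simpa using h)
        simpa [Function.comp_def, hF, norm_smul] using this
      have h2 : Summable fun k => γ ^ t * (γ ^ k * rew (ω (t + k))) :=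
        ((summable_mul_right_iff (norm_ne_zero_iff.2 hsc)).1 h1).of_abs
      simp only [hF]
      rw [h2.tsum_smul_const, tsum_mul_left]
  have h1 := hasSum_integral_of_summable_integral_norm hFint hFsum
  rw [hfubini]
  have h2 := (innerSL ℝ v).hasSum h1
  have h3 : ∀ p, innerSL ℝ v (∫ ω, F p ω ∂P)
      = ∫ ω, γ ^ p.1 * (γ ^ p.2 * (inner ℝ v (score (ω p.1)) * rew (ω (p.1 + p.2)))) ∂P := by
    intro p
    rw [innerSL_apply_apply, ← integral_inner (hFint p)]
    congr 1
    ext1 ω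
    simp only [hF, inner_smul_right]
    ring
  simp_rw [h3] at h2
  have h4 := h2.prod_fiberwise
    (fun t => H.hasSum_integral_mul_reward hn d hrew hK0 hK hZr hφm hφi t)
  -- an envelope that vanishes on `Z`
  obtain ⟨m, hm⟩ := exists_abs_le_of_finite fun s => ∫ z, |(inner ℝ v (score z) : ℝ)| ∂κ s
  have hm' : ∀ s, ∫ z, |(inner ℝ v (score z) : ℝ)| ∂κ s ≤ |m| := fun s =>
    (le_abs_self _).trans ((hm s).trans (le_abs_self m))
  have hsa : 0 ≤ ∑' k, a k := tsum_nonneg H.a_nonneg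
  have hdom := abs_integral_reward_le (κ := κ) hK0 hK hZr
  have hg_le : ∀ s, |((fun s => ∫ z, inner ℝ v (score z) * rew z ∂κ s)
          + γ • weightedTransition κ nxt (fun z => inner ℝ v (score z))
            (potential κ nxt γ fun s => ∫ z, rew z ∂κ s)) s|
      ≤ (K * |m| + K * (∑' k, a k) * |m|) * Zᶜ.indicator 1 s := by
    intro s
    have h1 := abs_integral_mul_reward_le hK0 hK hZr hφi hm' s
    have h2 := abs_weightedTransition_le hn H.closed hφi hm' (mul_nonneg hK0 hsa)
      (H.abs_potential_le hn hK0 hdom) s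
    rw [Pi.add_apply, Pi.smul_apply, smul_eq_mul, add_mul]
    refine (abs_add_le _ _).trans (add_le_add h1 ?_)
    rw [abs_mul, abs_of_nonneg H.γ_nonneg]
    exact (mul_le_of_le_one_left (abs_nonneg _) H.γ_le_one).trans h2
  have hc : 0 ≤ K * |m| + K * (∑' k, a k) * |m| := by positivity
  exact h4.unique ((expectationCLM d).hasSum (H.hasSum_potential hn hc hg_le))

end IsSummablyAbsorbed

end Returns

/-! ### Discounted and episodic tasks -/

section Absorption

set_option linter.unusedSectionVars false

variable {S E : Type*} [Fintype S] [MeasurableSpace S] [MeasurableSingletonClass S]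
  [MeasurableSpace E] {κ : Kernel S E} [IsMarkovKernel κ] {nxt : E → S}

lemma isSummablyAbsorbed_of_lt_one (hn : Measurable nxt) {γ : ℝ} (hγ0 : 0 ≤ γ) (hγ : γ < 1) :
    IsSummablyAbsorbed κ nxt γ ∅ fun k => γ ^ k where
  γ_nonneg := hγ0
  γ_le_one := hγ.le
  closed := by simp
  a_nonneg k := pow_nonneg hγ0 k
  summable := summable_geometric_of_lt_one hγ0 hγ
  pow_le k s := by
    have h : ∀ k, (weightedTransition κ nxt 1 ^ k) (1 : S → ℝ) = 1 := by
      intro k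
      induction k with
      | zero => rfl
      | succ k ih =>
        rw [pow_succ', mul_apply_eq_comp, ih]
        ext s
        rw [weightedTransition_one_apply hn]
        simp
    simp [h]

/-- If the chain of states reaches the closed set `Z` almost surely from every state, then the
probabilities of not having reached it decay geometrically, as the state set is finite: their
suprema `b k` over the starting states tend to zero and are submultiplicative. -/
lemma isSummablyAbsorbed_of_ae_reaches (hn : Measurable nxt) {st : E → S} (hst : Measurable st)
    (h_start : ∀ s, ∀ᵐ z ∂κ s, st z = s) {Z : Set S} (hZ : ∀ s ∈ Z, ∀ᵐ z ∂κ s, nxt z ∈ Z)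
    (h_reach : ∀ s, ∀ᵐ ω ∂chainMeasure κ hn (Measure.dirac s), ∃ t, st (ω t) ∈ Z) :
    IsSummablyAbsorbed κ nxt 1 Z
      fun k => ‖(weightedTransition κ nxt 1 ^ k) (Zᶜ.indicator 1 : S → ℝ)‖ := by
  set T := weightedTransition κ nxt 1 with hT
  set e : S → ℝ := Zᶜ.indicator 1 with he
  have he0 : ∀ s, 0 ≤ e s := indicator_compl_nonneg Z
  have he1 : ∀ s, e s ≤ 1 := indicator_compl_le_one Z
  have hpow0 : ∀ k s, 0 ≤ (T ^ k) e s := by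
    intro k s
    have := weightedTransition_one_pow_mono (κ := κ) hn (f := 0) (g := e) he0 k s
    rwa [map_zero] at this
  -- `Z` is closed, so nothing comes back from it
  have habs : ∀ {f : S → ℝ} {c : ℝ}, 0 ≤ c → (∀ s, |f s| ≤ c * e s) →
      ∀ s, |T f s| ≤ c * e s := by
    intro f c hc hf s
    have := abs_weightedTransition_le hn hZ (φ := 1) (m := 1)
      (fun s => integrable_const (1 : ℝ)) (fun s => by simp) hc hf s
    simpa using this
  have hpow_env : ∀ k s, |(T ^ k) e s| ≤ 1 * e s := by
    intro k
    induction k with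
    | zero => intro s; simp [abs_of_nonneg (he0 s)]
    | succ k ih =>
      rw [pow_succ', mul_apply_eq_comp]
      exact habs zero_le_one ih
  have hle : ∀ k s, (T ^ k) e s ≤ ‖(T ^ k) e‖ * e s := by
    intro k s
    by_cases hs : s ∈ Z
    · have := hpow_env k s
      simp only [he, Set.mem_compl_iff, hs, not_true_eq_false, not_false_eq_true,
        Set.indicator_of_notMem, mul_zero] at this ⊢
      exact (abs_nonpos_iff.1 this).le
    · have : e s = 1 := by simp [he, hs]
      rw [this, mul_one]
      exact (le_abs_self _).trans (norm_le_pi_norm ((T ^ k) e) s)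
  have hb1 : ∀ k, ‖(T ^ k) e‖ ≤ 1 := by
    intro k
    refine (pi_norm_le_iff_of_nonneg zero_le_one).2 fun s => ?_
    exact (hpow_env k s).trans (by rw [one_mul]; exact he1 s)
  have hsub : ∀ j k, ‖(T ^ (j + k)) e‖ ≤ ‖(T ^ k) e‖ * ‖(T ^ j) e‖ := by
    intro j k
    refine (pi_norm_le_iff_of_nonneg (by positivity)).2 fun s => ?_
    have h1 := weightedTransition_one_pow_mono (κ := κ) hn
      (f := (T ^ k) e) (g := ‖(T ^ k) e‖ • e) (hle k) j s
    rw [map_smul, Pi.smul_apply, smul_eq_mul] at h1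
    rw [pow_add, mul_apply_eq_comp]
    have h0 : 0 ≤ (T ^ j) ((T ^ k) e) s := by
      have := hpow0 (j + k) s
      rwa [pow_add] at this
    rw [Real.norm_of_nonneg h0]
    refine h1.trans ?_
    gcongr
    exact (le_abs_self _).trans (norm_le_pi_norm ((T ^ j) e) s)
  -- the probabilities of not having reached `Z` tend to zero
  have hlim : ∀ s, Tendsto (fun k => (T ^ k) e s) atTop (𝓝 0) := by
    intro s
    have hem : Measurable fun z => e (st z) := (measurable_of_finite e).comp hst
    have heb : ∀ z, |e (st z)| ≤ 1 := fun z => by rw [abs_of_nonneg (he0 _)]; exact he1 _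
    have h1 : ∀ k, (T ^ k) e s = ∫ ω, e (st (ω k)) ∂chainMeasure κ hn (Measure.dirac s) := by
      intro k
      rw [integral_chainMeasure hn _ (φ := fun z => e (st z)) hem.stronglyMeasurable
        (integrable_of_abs_le hem heb), integral_dirac]
      have : (fun s => ∫ z, e (st z) ∂κ s) = e := by
        ext s
        rw [integral_congr_ae (g := fun _ => e s)
          ((h_start s).mono fun z hz => by simp only [hz])]
        simp
      rw [this]
    simp_rw [h1]
    have hclosed : ∀ᵐ ω ∂chainMeasure κ hn (Measure.dirac s), ∀ t, st (ω t) ∈ Z → nxt (ω t) ∈ Z := by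
      refine ae_chainMeasure_of_forall hn _ (q := fun z => st z ∈ Z → nxt z ∈ Z) ?_ fun s' => ?_
      · have h2 : {z | st z ∈ Z → nxt z ∈ Z} = (st ⁻¹' Z)ᶜ ∪ nxt ⁻¹' Z := by
          ext z
          simp [imp_iff_not_or]
        rw [h2]
        exact (hst Z.toFinite.measurableSet).compl.union (hn Z.toFinite.measurableSet)
      · by_cases hs' : s' ∈ Z
        · filter_upwards [hZ s' hs'] with z hz _ using hz
        · filter_upwards [h_start s'] with z hz hz'
          exact absurd (hz ▸ hz') hs'
    have h3 := tendsto_integral_of_dominated_convergence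
      (μ := chainMeasure κ hn (Measure.dirac s)) (F := fun k ω => e (st (ω k)))
      (f := fun _ => 0) (fun _ => 1)
      (fun k => (hem.comp (measurable_pi_apply k)).aestronglyMeasurable) (integrable_const _)
      (fun k => ae_of_all _ fun ω => heb (ω k)) (by
        filter_upwards [h_reach s, hclosed, ae_chainMeasure_start_succ hn (Measure.dirac s) hst
          h_start] with ω ⟨t, ht⟩ h4 h5
        have h6 : ∀ k ≥ t, st (ω k) ∈ Z := by
          intro k hk
          induction k, hk using Nat.le_induction with
          | base => exact ht
          | succ k _ ih => rw [h5 k]; exact h4 k ih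
        refine tendsto_const_nhds.congr' ?_
        filter_upwards [eventually_ge_atTop t] with k hk
        simp [he, h6 k hk])
    simpa using h3
  obtain ⟨k₀, hk₀⟩ : ∃ k₀, ‖(T ^ k₀) e‖ ≤ 1 / 2 := by
    have h1 : ∀ᶠ k in atTop, ∀ s, (T ^ k) e s < 1 / 2 :=
      eventually_all.2 fun s => (hlim s).eventually (gt_mem_nhds (by norm_num))
    obtain ⟨k₀, hk₀⟩ := h1.exists
    refine ⟨k₀, (pi_norm_le_iff_of_nonneg (by norm_num)).2 fun s => ?_⟩
    rw [Real.norm_of_nonneg (hpow0 _ _)]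
    exact (hk₀ s).le
  have hsum : Summable fun k => ‖(T ^ k) e‖ := by
    refine summable_of_sum_range_le (c := 2 * k₀) (fun k => norm_nonneg _) fun n => ?_
    have h1 : ∑ k ∈ Finset.range n, ‖(T ^ k) e‖
        ≤ ∑ k ∈ Finset.range (k₀ + n), ‖(T ^ k) e‖ :=
      Finset.sum_le_sum_of_subset_of_nonneg (Finset.range_subset_range.2 (by omega))
        fun k _ _ => norm_nonneg _
    rw [Finset.sum_range_add] at h1
    have h2 : ∑ k ∈ Finset.range k₀, ‖(T ^ k) e‖ ≤ k₀ := by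
      simpa using Finset.sum_le_sum fun k (_ : k ∈ Finset.range k₀) => hb1 k
    have h3 : ∑ k ∈ Finset.range n, ‖(T ^ (k₀ + k)) e‖
        ≤ 1 / 2 * ∑ k ∈ Finset.range n, ‖(T ^ k) e‖ := by
      rw [Finset.mul_sum]
      refine Finset.sum_le_sum fun k _ => ?_
      rw [add_comm]
      exact (hsub k k₀).trans (mul_le_mul_of_nonneg_right hk₀ (norm_nonneg _))
    linarith
  exact ⟨zero_le_one, le_rfl, hZ, fun k => norm_nonneg _, hsum, fun k s => by
    rw [one_pow, one_mul]
    exact hle k s⟩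

end Absorption

/-! ### Differentiability of the value function -/

section ValueFunction

set_option linter.unusedSectionVars false

variable {S E : Type*} [Fintype S] [MeasurableSpace S] [MeasurableSingletonClass S]
  [MeasurableSpace E] {V : Type*} [NormedAddCommGroup V] [NormedSpace ℝ V]
  {κ : V → Kernel S E} [∀ θ, IsMarkovKernel (κ θ)] {nxt : E → S} {γ : ℝ} {Z : Set S}

/-- The entries of the killed transition operator are expectations of bounded functions. -/
lemma killed_apply_eq_sum (hn : Measurable nxt) (θ : V) (f : S → ℝ) (s : S) :
    weightedTransition (κ θ) nxt (fun z => Zᶜ.indicator 1 (nxt z)) f s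
      = ∑ s', (∫ z, (({s'} ∩ Zᶜ : Set S).indicator 1 (nxt z) : ℝ) ∂κ θ s) * f s' := by
  rw [weightedTransition_apply hn (integrable_comp_next hn _ s)]
  simp_rw [← integral_mul_const]
  rw [← integral_finsetSum _ fun s' _ => (integrable_comp_next hn _ s).mul_const _]
  refine integral_congr_ae (ae_of_all _ fun z => ?_)
  simp only
  rw [Finset.sum_eq_single (nxt z)]
  · by_cases hz : nxt z ∈ Z <;> simp [hz]
  · intro s' _ hs'
    simp [hs'.symm]
  · simp

lemma abs_indicator_one_le (A : Set S) (s : S) : |(A.indicator 1 s : ℝ)| ≤ 1 := by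
  by_cases hs : s ∈ A <;> simp [hs]

lemma differentiable_killed (hn : Measurable nxt)
    (hdiff : ∀ ψ : E → ℝ, Measurable ψ → (∃ K, ∀ z, |ψ z| ≤ K) → ∀ s,
      Differentiable ℝ fun θ => ∫ z, ψ z ∂κ θ s) :
    Differentiable ℝ fun θ =>
      weightedTransition (κ θ) nxt (fun z => Zᶜ.indicator 1 (nxt z)) := by
  classical
  have h : ∀ θ, weightedTransition (κ θ) nxt (fun z => Zᶜ.indicator 1 (nxt z))
      = ∑ s, ∑ s', (∫ z, (({s'} ∩ Zᶜ : Set S).indicator 1 (nxt z) : ℝ) ∂κ θ s) •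
        ((ContinuousLinearMap.single ℝ (fun _ : S => ℝ) s).comp
          (ContinuousLinearMap.proj (R := ℝ) (φ := fun _ : S => ℝ) s')) := by
    intro θ
    ext1 f
    ext s
    rw [killed_apply_eq_sum hn]
    simp [Finset.sum_apply, Pi.single_apply]
  simp_rw [h]
  refine Differentiable.fun_sum fun s _ => Differentiable.fun_sum fun s' _ => ?_
  exact (hdiff _ ((measurable_of_finite (({s'} ∩ Zᶜ : Set S).indicator (1 : S → ℝ))).comp hn)
    ⟨1, fun z => abs_indicator_one_le _ _⟩ s).smul_const _

variable {rew : E → ℝ} {K : ℝ}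

lemma potential_eq_inverse (hn : Measurable nxt) {θ : V} {a : ℕ → ℝ}
    (H : IsSummablyAbsorbed (κ θ) nxt γ Z a) (hK0 : 0 ≤ K) (hK : ∀ z, |rew z| ≤ K)
    (hZr : ∀ s ∈ Z, ∀ᵐ z ∂κ θ s, rew z = 0) :
    potential (κ θ) nxt γ (fun s => ∫ z, rew z ∂κ θ s)
      = Ring.inverse (1 - γ • weightedTransition (κ θ) nxt (fun z => Zᶜ.indicator 1 (nxt z)))
        (fun s => ∫ z, rew z ∂κ θ s) := by
  set A := 1 - γ • weightedTransition (κ θ) nxt (fun z => Zᶜ.indicator 1 (nxt z)) with hA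
  have hu : IsUnit A := H.isUnit_one_sub_killed hn
  symm
  refine H.eq_potential hn hK0 (IsSummablyAbsorbed.abs_integral_reward_le hK0 hK hZr) ?_
  set r : S → ℝ := fun s => ∫ z, rew z ∂κ θ s
  have h1 : A (Ring.inverse A r) = r := by
    rw [← mul_apply_eq_comp, Ring.mul_inverse_cancel A hu, one_apply_eq_self]
  have h2 : A (Ring.inverse A r) = Ring.inverse A r
      - γ • weightedTransition (κ θ) nxt (fun z => Zᶜ.indicator 1 (nxt z)) (Ring.inverse A r) := by
    conv_lhs => rw [hA]
    rfl
  rw [h1] at h2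
  exact (eq_sub_iff_add_eq.1 h2).symm

/-- The value function is a differentiable function of the parameters. -/
lemma differentiable_potential (hn : Measurable nxt)
    (hdiff : ∀ ψ : E → ℝ, Measurable ψ → (∃ K, ∀ z, |ψ z| ≤ K) → ∀ s,
      Differentiable ℝ fun θ => ∫ z, ψ z ∂κ θ s)
    (H : ∀ θ, ∃ a, IsSummablyAbsorbed (κ θ) nxt γ Z a) (hrew : Measurable rew)
    (hK0 : 0 ≤ K) (hK : ∀ z, |rew z| ≤ K)
    (hZr : ∀ θ, ∀ s ∈ Z, ∀ᵐ z ∂κ θ s, rew z = 0) :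
    Differentiable ℝ fun θ => potential (κ θ) nxt γ (fun s => ∫ z, rew z ∂κ θ s) := by
  have h : ∀ θ, potential (κ θ) nxt γ (fun s => ∫ z, rew z ∂κ θ s)
      = Ring.inverse (1 - γ • weightedTransition (κ θ) nxt (fun z => Zᶜ.indicator 1 (nxt z)))
        (fun s => ∫ z, rew z ∂κ θ s) := fun θ => by
    obtain ⟨a, ha⟩ := H θ
    exact potential_eq_inverse hn ha hK0 hK (hZr θ)
  simp_rw [h]
  intro θ
  obtain ⟨a, ha⟩ := H θ
  refine DifferentiableAt.clm_apply ?_ ?_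
  · exact (differentiableAt_inverse (𝕜 := ℝ) (ha.isUnit_one_sub_killed hn)).comp θ
      (((differentiable_const 1).sub ((differentiable_killed hn hdiff).const_smul γ)) θ)
  · exact differentiableAt_pi.2 fun s => hdiff rew hrew ⟨K, hK⟩ s θ

/-- The derivative of the value function: if derivatives of expectations over one step in
the direction `w` are expectations against the score `φ`, then the derivative of the value function
is the potential of the expected products of `φ` and reward plus next value. -/
theorem fderiv_potential_apply (hn : Measurable nxt)
    (hdiff : ∀ ψ : E → ℝ, Measurable ψ → (∃ K, ∀ z, |ψ z| ≤ K) → ∀ s,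
      Differentiable ℝ fun θ => ∫ z, ψ z ∂κ θ s)
    (H : ∀ θ, ∃ a, IsSummablyAbsorbed (κ θ) nxt γ Z a) (hrew : Measurable rew)
    (hK0 : 0 ≤ K) (hK : ∀ z, |rew z| ≤ K)
    (hZr : ∀ θ, ∀ s ∈ Z, ∀ᵐ z ∂κ θ s, rew z = 0)
    {θ w : V} {φ : E → ℝ} (hφ : ∀ s, Integrable φ (κ θ s))
    (hφd : ∀ ψ : E → ℝ, Measurable ψ → (∃ K, ∀ z, |ψ z| ≤ K) → ∀ s,
      fderiv ℝ (fun θ => ∫ z, ψ z ∂κ θ s) θ w = ∫ z, φ z * ψ z ∂κ θ s) :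
    fderiv ℝ (fun θ => potential (κ θ) nxt γ (fun s => ∫ z, rew z ∂κ θ s)) θ w
      = potential (κ θ) nxt γ ((fun s => ∫ z, φ z * rew z ∂κ θ s)
          + γ • weightedTransition (κ θ) nxt φ
            (potential (κ θ) nxt γ fun s => ∫ z, rew z ∂κ θ s)) := by
  set v : V → S → ℝ := fun θ => potential (κ θ) nxt γ (fun s => ∫ z, rew z ∂κ θ s) with hv
  have hvdiff : Differentiable ℝ v := differentiable_potential hn hdiff H hrew hK0 hK hZr
  obtain ⟨a, ha⟩ := H θ
  have hdom := fun θ => IsSummablyAbsorbed.abs_integral_reward_le (κ := κ θ) hK0 hK (hZr θ)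
  have hvzero : ∀ θ, ∀ s ∈ Z, v θ s = 0 := by
    intro θ s hs
    obtain ⟨a, ha⟩ := H θ
    simpa [hs] using ha.abs_potential_le hn hK0 (hdom θ) s
  have hv_eq : ∀ s θ, v θ s = ∫ z, rew z ∂κ θ s
      + γ * ∑ s', (∫ z, (({s'} ∩ Zᶜ : Set S).indicator 1 (nxt z) : ℝ) ∂κ θ s) * v θ s' := by
    intro s θ
    obtain ⟨a, ha⟩ := H θ
    have h1 := congrFun (ha.potential_eq hn hK0 (hdom θ)) s
    rw [← IsSummablyAbsorbed.killed_apply hn (hvzero θ), Pi.add_apply, Pi.smul_apply,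
      killed_apply_eq_sum hn, smul_eq_mul] at h1
    exact h1
  have hvs : ∀ s, HasFDerivAt (fun θ => v θ s)
      ((ContinuousLinearMap.proj s).comp (fderiv ℝ v θ)) θ := fun s =>
    (ContinuousLinearMap.proj (R := ℝ) (φ := fun _ : S => ℝ) s).hasFDerivAt.comp θ
      (hvdiff θ).hasFDerivAt
  have hqm : ∀ s', Measurable fun z => (({s'} ∩ Zᶜ : Set S).indicator 1 (nxt z) : ℝ) := fun s' =>
    (measurable_of_finite (({s'} ∩ Zᶜ : Set S).indicator (1 : S → ℝ))).comp hn
  -- an envelope that vanishes on `Z`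
  obtain ⟨m, hm⟩ := exists_abs_le_of_finite fun s => ∫ z, |φ z| ∂κ θ s
  have hm' : ∀ s, ∫ z, |φ z| ∂κ θ s ≤ |m| := fun s =>
    (le_abs_self _).trans ((hm s).trans (le_abs_self m))
  have hsa : 0 ≤ ∑' k, a k := tsum_nonneg ha.a_nonneg
  have hg_le : ∀ s, |((fun s => ∫ z, φ z * rew z ∂κ θ s)
          + γ • weightedTransition (κ θ) nxt φ (v θ)) s|
      ≤ (K * |m| + K * (∑' k, a k) * |m|) * Zᶜ.indicator 1 s := by
    intro s
    have h1 := abs_integral_mul_reward_le hK0 hK (hZr θ) hφ hm' s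
    have h2 := abs_weightedTransition_le hn ha.closed hφ hm' (mul_nonneg hK0 hsa)
      (ha.abs_potential_le hn hK0 (hdom θ)) s
    rw [Pi.add_apply, Pi.smul_apply, smul_eq_mul, add_mul]
    refine (abs_add_le _ _).trans (add_le_add h1 ?_)
    rw [abs_mul, abs_of_nonneg ha.γ_nonneg]
    exact (mul_le_of_le_one_left (abs_nonneg _) ha.γ_le_one).trans h2
  refine ha.eq_potential hn (by positivity) hg_le ?_
  -- differentiate the Poisson equation
  ext s
  have h1 : HasFDerivAt (fun θ => ∫ z, rew z ∂κ θ s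
      + γ * ∑ s', (∫ z, (({s'} ∩ Zᶜ : Set S).indicator 1 (nxt z) : ℝ) ∂κ θ s) * v θ s') _ θ :=
    (hdiff rew hrew ⟨K, hK⟩ s θ).hasFDerivAt.add
      ((HasFDerivAt.fun_sum fun s' _ => ((hdiff _ (hqm s')
        ⟨1, fun z => abs_indicator_one_le _ _⟩ s θ).hasFDerivAt.mul (hvs s'))).const_mul γ)
  rw [← funext (hv_eq s)] at h1
  have h2 := DFunLike.congr_fun ((hvs s).unique h1) w
  simp only [ContinuousLinearMap.comp_apply, ContinuousLinearMap.proj_apply,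
    _root_.add_apply, _root_.smul_apply,
    _root_.sum_apply, smul_eq_mul] at h2
  rw [h2, hφd rew hrew ⟨K, hK⟩ s]
  have h3 : weightedTransition (κ θ) nxt φ (v θ) s
      = ∑ s', (∫ z, φ z * ({s'} ∩ Zᶜ : Set S).indicator 1 (nxt z) ∂κ θ s) * v θ s' := by
    rw [weightedTransition_apply hn (hφ s)]
    simp_rw [← integral_mul_const]
    rw [← integral_finsetSum _ fun s' _ => ((hφ s).mul_bdd (hqm s').aestronglyMeasurable
      (ae_of_all _ fun z => abs_indicator_one_le _ _)).mul_const _]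
    refine integral_congr_ae (ae_of_all _ fun z => ?_)
    simp only
    rw [Finset.sum_eq_single (nxt z)]
    · by_cases hz : nxt z ∈ Z
      · simp [hz, hvzero θ _ hz]
      · simp [hz]
    · intro s' _ hs'
      simp [hs'.symm]
    · simp
  simp only [Pi.add_apply, Pi.smul_apply, smul_eq_mul]
  rw [h3, killed_apply_eq_sum hn, add_assoc, ← mul_add, ← Finset.sum_add_distrib]
  congr 2
  refine Finset.sum_congr rfl fun s' _ => ?_
  rw [hφd _ (hqm s') ⟨1, fun z => abs_indicator_one_le _ _⟩ s]
  ring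

end ValueFunction

/-! ### Derivatives and scores of the joint density -/

namespace CoagentNetwork

set_option linter.unusedSectionVars false

variable {S A : Type*} [MeasurableSpace S] [MeasurableSpace A] {m : ℕ}
  {U : Fin m → Type*} [∀ i, MeasurableSpace (U i)] {n : Fin m → ℕ}
  (N : CoagentNetwork S A U n)

lemma jointDensity_nonneg (s : S) (u : ∀ i, U i) (θ : Params n) : 0 ≤ N.jointDensity s u θ :=
  Finset.prod_nonneg fun _ _ => N.policy_nonneg _ _ _ _

lemma measurable_localState (i : Fin m) :
    Measurable fun p : S × (∀ i, U i) => (localState p.1 p.2 i, p.2 i) := by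
  unfold localState
  fun_prop

lemma measurable_jointDensity (s : S) (θ : Params n) :
    Measurable fun u => N.jointDensity s u θ := by
  unfold jointDensity
  refine Finset.measurable_fun_prod _ fun i _ => ?_
  exact (N.policy_measurable i (θ i)).comp ((measurable_localState i).comp measurable_prodMk_left)

lemma integrable_jointDensity (s : S) (θ : Params n) :
    Integrable (fun u => N.jointDensity s u θ) (Measure.pi N.ν) := by
  refine ⟨(N.measurable_jointDensity s θ).aestronglyMeasurable, ?_⟩
  rw [hasFiniteIntegral_iff_ofReal (ae_of_all _ fun u => N.jointDensity_nonneg s u θ),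
    N.lintegral_jointDensity]
  exact ENNReal.one_lt_top

/-- The inclusion of the parameters of the `i`-th coagent as a direction in the parameter space. -/
noncomputable def coordinateDirection (i : Fin m) (v : EuclideanSpace ℝ (Fin (n i))) : Params n :=
  WithLp.toLp 2 (Pi.single i v)

lemma inner_coordinateDirection (i : Fin m) (v : EuclideanSpace ℝ (Fin (n i))) (x : Params n) :
    inner ℝ (coordinateDirection i v) x = inner ℝ v (x i) := by
  rw [PiLp.inner_apply (coordinateDirection i v) x, Finset.sum_eq_single i]
  · simp [coordinateDirection]
  · intro j _ hj
    simp [coordinateDirection, hj]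
  · simp

lemma hasFDerivAt_policy_comp (s : S) (u : ∀ i, U i) (θ : Params n) (i : Fin m) :
    HasFDerivAt (fun θ : Params n => N.policy i (localState s u i) (u i) (θ i))
      ((fderiv ℝ (N.policy i (localState s u i) (u i)) (θ i)).comp
        (PiLp.proj (𝕜 := ℝ) 2 (fun i : Fin m => EuclideanSpace ℝ (Fin (n i))) i)) θ :=
  (N.policy_differentiable i _ _ (θ i)).hasFDerivAt.comp θ
    (PiLp.proj (𝕜 := ℝ) 2 (fun i : Fin m => EuclideanSpace ℝ (Fin (n i))) i).hasFDerivAt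

lemma differentiable_jointDensity (s : S) (u : ∀ i, U i) :
    Differentiable ℝ (N.jointDensity s u) := fun θ =>
  (HasFDerivAt.finsetProd (u := Finset.univ) fun i _ =>
    N.hasFDerivAt_policy_comp s u θ i).differentiableAt

/-- The score of the `i`-th coagent, in the form `∇π / π`: unlike the gradient of `log π`, it is
zero where `π` vanishes. -/
noncomputable def score (i : Fin m) (θ : Params n) (s : S) (u : ∀ i, U i) :
    EuclideanSpace ℝ (Fin (n i)) :=
  (N.policy i (localState s u i) (u i) (θ i))⁻¹ •
    gradient (N.policy i (localState s u i) (u i)) (θ i)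

lemma gradient_log_policy (i : Fin m) (θ : Params n) (s : S) (u : ∀ i, U i)
    (h : N.jointDensity s u θ ≠ 0) :
    gradient (fun ϑ => Real.log (N.policy i (localState s u i) (u i) ϑ)) (θ i)
      = N.score i θ s u := by
  have hne : N.policy i (localState s u i) (u i) (θ i) ≠ 0 := fun h0 =>
    h (Finset.prod_eq_zero (Finset.mem_univ i) h0)
  have h1 := (N.policy_differentiable i (localState s u i) (u i) (θ i)).hasFDerivAt.log hne
  rw [score, gradient, h1.fderiv, gradient, map_smul]

/-- The derivative of the joint density in the parameters of one coagent is the joint density times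
the score. Where the policy vanishes, it has a minimum, so that its derivative vanishes too. -/
lemma fderiv_jointDensity_coordinateDirection (s : S) (u : ∀ i, U i) (θ : Params n) (i : Fin m)
    (v : EuclideanSpace ℝ (Fin (n i))) :
    fderiv ℝ (N.jointDensity s u) θ (coordinateDirection i v)
      = inner ℝ v (N.score i θ s u) * N.jointDensity s u θ := by
  classical
  have h1 : HasFDerivAt (N.jointDensity s u) _ θ :=
    HasFDerivAt.finsetProd (u := Finset.univ) fun i _ => N.hasFDerivAt_policy_comp s u θ i
  rw [h1.fderiv, _root_.sum_apply, Finset.sum_eq_single i]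
  · have hv : (PiLp.proj (𝕜 := ℝ) 2 (fun i : Fin m => EuclideanSpace ℝ (Fin (n i))) i)
        (coordinateDirection i v) = v := by
      simp [coordinateDirection]
    rw [_root_.smul_apply, ContinuousLinearMap.comp_apply, hv, score, inner_smul_right,
      smul_eq_mul, real_inner_comm, gradient, InnerProductSpace.toDual_symm_apply, jointDensity,
      ← Finset.mul_prod_erase _ _ (Finset.mem_univ i)]
    by_cases h0 : N.policy i (localState s u i) (u i) (θ i) = 0
    · have hmin : IsLocalMin (N.policy i (localState s u i) (u i)) (θ i) :=
        Eventually.of_forall fun ϑ => by rw [h0]; exact N.policy_nonneg _ _ _ _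
      rw [hmin.fderiv_eq_zero]
      simp
    · field_simp
  · intro j _ hj
    have hv : (PiLp.proj (𝕜 := ℝ) 2 (fun i : Fin m => EuclideanSpace ℝ (Fin (n i))) j)
        (coordinateDirection i v) = 0 := by
      simp [coordinateDirection, hj]
    rw [_root_.smul_apply, ContinuousLinearMap.comp_apply, hv, map_zero, smul_zero]
  · simp

lemma measurable_fderiv_policy_apply (i : Fin m) (ϑ v : EuclideanSpace ℝ (Fin (n i))) :
    Measurable fun p : LocalState S U i × U i => fderiv ℝ (N.policy i p.1 p.2) ϑ v := by
  refine measurable_of_tendsto_metrizable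
    (f := fun (k : ℕ) p => (k : ℝ) • (N.policy i p.1 p.2 (ϑ + (k : ℝ)⁻¹ • v) - N.policy i p.1 p.2 ϑ))
    (fun k => ((N.policy_measurable i (ϑ + (k : ℝ)⁻¹ • v)).sub
      (N.policy_measurable i ϑ)).const_smul (k : ℝ))
    (tendsto_pi_nhds.2 fun p => ?_)
  exact (N.policy_differentiable i p.1 p.2 ϑ).hasFDerivAt.lim v
    (tendsto_norm_atTop_atTop.comp tendsto_natCast_atTop_atTop)

lemma measurable_score (i : Fin m) (θ : Params n) :
    Measurable fun p : S × (∀ i, U i) => N.score i θ p.1 p.2 := by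
  have hg : Measurable fun p : LocalState S U i × U i => gradient (N.policy i p.1 p.2) (θ i) := by
    have h : ∀ p : LocalState S U i × U i, gradient (N.policy i p.1 p.2) (θ i)
        = ∑ j, (fderiv ℝ (N.policy i p.1 p.2) (θ i) (EuclideanSpace.basisFun _ ℝ j)) •
          EuclideanSpace.basisFun (Fin (n i)) ℝ j := by
      intro p
      rw [← (EuclideanSpace.basisFun (Fin (n i)) ℝ).sum_repr' (gradient _ _)]
      refine Finset.sum_congr rfl fun j _ => ?_
      rw [real_inner_comm, gradient, InnerProductSpace.toDual_symm_apply]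
    simp_rw [h]
    exact Finset.measurable_fun_sum _ fun j _ =>
      (N.measurable_fderiv_policy_apply i (θ i) _).smul_const _
  exact (((N.policy_measurable i (θ i)).inv.smul hg).comp (measurable_localState i))

section InMean

variable {N}

lemma measurable_fderiv_jointDensity_apply (s : S) (θ h : Params n) :
    Measurable fun u => fderiv ℝ (N.jointDensity s u) θ h := by
  refine measurable_of_tendsto_metrizable
    (f := fun (k : ℕ) u => (k : ℝ) • (N.jointDensity s u (θ + (k : ℝ)⁻¹ • h)
      - N.jointDensity s u θ))
    (fun k => ((N.measurable_jointDensity s (θ + (k : ℝ)⁻¹ • h)).sub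
      (N.measurable_jointDensity s θ)).const_smul (k : ℝ))
    (tendsto_pi_nhds.2 fun u => ?_)
  exact (N.differentiable_jointDensity s u θ).hasFDerivAt.lim h
    (tendsto_norm_atTop_atTop.comp tendsto_natCast_atTop_atTop)

/-- The error of the first-order expansion of the joint density. -/
lemma measurable_jointDensity_error (s : S) (θ θ' : Params n) :
    Measurable fun u => N.jointDensity s u θ' - N.jointDensity s u θ
      - fderiv ℝ (N.jointDensity s u) θ (θ' - θ) :=
  ((N.measurable_jointDensity s θ').sub (N.measurable_jointDensity s θ)).sub
    (measurable_fderiv_jointDensity_apply s θ _)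

lemma integrable_fderiv_jointDensity_apply (hN : N.DifferentiableInMean) (s : S) (θ h : Params n) :
    Integrable (fun u => fderiv ℝ (N.jointDensity s u) θ h) (Measure.pi N.ν) := by
  have hlim : Tendsto (fun c : ℝ => θ + c • h) (𝓝[>] 0) (𝓝 θ) := by
    have h1 : Continuous fun c : ℝ => θ + c • h := by fun_prop
    have h2 := h1.tendsto 0
    rw [zero_smul, add_zero] at h2
    exact h2.mono_left nhdsWithin_le_nhds
  obtain ⟨c, hc, hc0⟩ := ((hlim.eventually (hN s θ 1 one_pos)).and self_mem_nhdsWithin).exists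
  have hc0 : (0 : ℝ) < c := hc0
  have herr : Integrable (fun u => N.jointDensity s u (θ + c • h) - N.jointDensity s u θ
      - fderiv ℝ (N.jointDensity s u) θ (θ + c • h - θ)) (Measure.pi N.ν) :=
    ⟨(measurable_jointDensity_error s θ _).aestronglyMeasurable,
      hc.trans_lt ENNReal.ofReal_lt_top⟩
  have h1 := (((N.integrable_jointDensity s (θ + c • h)).sub
    (N.integrable_jointDensity s θ)).sub herr).const_mul c⁻¹
  refine h1.congr (ae_of_all _ fun u => ?_)
  simp only [Pi.sub_apply, add_sub_cancel_left, map_smul, smul_eq_mul]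
  field_simp
  ring

/-- Expectations of bounded functions of the outputs are differentiable functions of the parameters,
and differentiation under the integral sign is allowed. -/
lemma hasFDerivAt_integral_mul_jointDensity (hN : N.DifferentiableInMean) (s : S) (θ : Params n)
    {Ψ : (∀ i, U i) → ℝ} (hΨ : Measurable Ψ) {K : ℝ} (hK : ∀ u, |Ψ u| ≤ K) :
    ∃ G : Params n →L[ℝ] ℝ,
      HasFDerivAt (fun θ => ∫ u, Ψ u * N.jointDensity s u θ ∂Measure.pi N.ν) G θ ∧
      ∀ h, G h = ∫ u, Ψ u * fderiv ℝ (N.jointDensity s u) θ h ∂Measure.pi N.ν := by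
  have hmul : ∀ {f : (∀ i, U i) → ℝ}, Integrable f (Measure.pi N.ν) →
      Integrable (fun u => Ψ u * f u) (Measure.pi N.ν) := fun hf =>
    hf.bdd_mul hΨ.aestronglyMeasurable (ae_of_all _ hK)
  have hd := integrable_fderiv_jointDensity_apply hN s θ
  set G : Params n →L[ℝ] ℝ := LinearMap.toContinuousLinearMap
    { toFun := fun h => ∫ u, Ψ u * fderiv ℝ (N.jointDensity s u) θ h ∂Measure.pi N.ν
      map_add' := fun h h' => by
        rw [← integral_add (hmul (hd h)) (hmul (hd h'))]
        simp_rw [map_add, mul_add]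
      map_smul' := fun c h => by
        rw [RingHom.id_apply, smul_eq_mul, ← integral_const_mul]
        simp_rw [map_smul, smul_eq_mul]
        congr 1
        ext u
        ring }
  have hG : ∀ h, G h = ∫ u, Ψ u * fderiv ℝ (N.jointDensity s u) θ h ∂Measure.pi N.ν := fun h => rfl
  refine ⟨G, HasFDerivAt.of_isLittleO (Asymptotics.IsLittleO.of_bound fun c hc => ?_), hG⟩
  filter_upwards [hN s θ (c / (|K| + 1)) (by positivity)] with θ' hθ'
  have herr : Integrable (fun u => N.jointDensity s u θ' - N.jointDensity s u θ
      - fderiv ℝ (N.jointDensity s u) θ (θ' - θ)) (Measure.pi N.ν) :=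
    ⟨(measurable_jointDensity_error s θ _).aestronglyMeasurable,
      hθ'.trans_lt ENNReal.ofReal_lt_top⟩
  have h1 : ∫ u, ‖N.jointDensity s u θ' - N.jointDensity s u θ
      - fderiv ℝ (N.jointDensity s u) θ (θ' - θ)‖ ∂Measure.pi N.ν
      ≤ c / (|K| + 1) * ‖θ' - θ‖ := by
    rw [integral_norm_eq_lintegral_enorm herr.1]
    exact ENNReal.toReal_le_of_le_ofReal (by positivity) hθ'
  have h2 : ∫ u, Ψ u * N.jointDensity s u θ' ∂Measure.pi N.ν
      - ∫ u, Ψ u * N.jointDensity s u θ ∂Measure.pi N.ν - G (θ' - θ)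
      = ∫ u, Ψ u * (N.jointDensity s u θ' - N.jointDensity s u θ
        - fderiv ℝ (N.jointDensity s u) θ (θ' - θ)) ∂Measure.pi N.ν := by
    have hsub : Integrable
        (fun u => Ψ u * N.jointDensity s u θ' - Ψ u * N.jointDensity s u θ) (Measure.pi N.ν) :=
      (hmul (N.integrable_jointDensity s θ')).sub (hmul (N.integrable_jointDensity s θ))
    rw [hG, ← integral_sub (hmul (N.integrable_jointDensity s θ'))
      (hmul (N.integrable_jointDensity s θ)), ← integral_sub hsub (hmul (hd _))]
    congr 1
    ext u
    ring
  rw [h2]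
  calc ‖∫ u, Ψ u * (N.jointDensity s u θ' - N.jointDensity s u θ
        - fderiv ℝ (N.jointDensity s u) θ (θ' - θ)) ∂Measure.pi N.ν‖
      ≤ ∫ u, |K| * ‖N.jointDensity s u θ' - N.jointDensity s u θ
        - fderiv ℝ (N.jointDensity s u) θ (θ' - θ)‖ ∂Measure.pi N.ν := by
        refine norm_integral_le_of_norm_le (herr.norm.const_mul _) (ae_of_all _ fun u => ?_)
        rw [norm_mul]
        gcongr
        exact (hK u).trans (le_abs_self K)
    _ ≤ |K| * (c / (|K| + 1) * ‖θ' - θ‖) := by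
        rw [integral_const_mul]
        gcongr
    _ = |K| / (|K| + 1) * (c * ‖θ' - θ‖) := by ring
    _ ≤ c * ‖θ' - θ‖ := by
        refine mul_le_of_le_one_left (by positivity) ?_
        rw [div_le_one (by positivity)]
        linarith

end InMean

end CoagentNetwork

/-! ### One time step of the process -/

section Step

set_option linter.unusedSectionVars false

variable {S A : Type*} [MeasurableSpace S] [MeasurableSpace A] {m : ℕ}
  {U : Fin m → Type*} [∀ i, MeasurableSpace (U i)] {n : Fin m → ℕ}
  [Finite S] [MeasurableSingletonClass S] [Finite A] [MeasurableSingletonClass A]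
  (M : MDP S A) (N : CoagentNetwork S A U n)

/-- The state in which a time step ends. -/
def nextState {M : MDP S A} (z : StepRecord M U) : S := z.2.2.1

/-- The reward of a time step. -/
def stepReward {M : MDP S A} (z : StepRecord M U) : ℝ := z.2.2.2

lemma measurable_nextState : Measurable (nextState (M := M) (U := U)) := by
  unfold nextState; fun_prop

lemma measurable_stepReward : Measurable (stepReward (M := M) (U := U)) := by
  unfold stepReward
  exact measurable_subtype_coe.comp (by fun_prop)

lemma exists_abs_stepReward_le :
    ∃ K, 0 ≤ K ∧ ∀ z : StepRecord M U, |stepReward z| ≤ K :=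
  ⟨∑ r ∈ M.rewards, |r|, Finset.sum_nonneg fun _ _ => abs_nonneg _, fun z =>
    Finset.single_le_sum (f := fun r : ℝ => |r|) (fun _ _ => abs_nonneg _) z.2.2.2.2⟩

lemma episode_eq_chainMeasure (θ : Params n) (d : PMF S) :
    episode M N θ d
      = chainMeasure (stepKernel M N θ) (measurable_nextState M) d.toMeasure := rfl

/-- The law of outputs, next state and reward in a given state. -/
lemma stepKernel_apply (θ : Params n) (s : S) :
    stepKernel M N θ s = ((N.outputKernel θ ⊗ₖ
      (envKernel M).comap _ (measurable_action_uncurry N)) s).map (Prod.mk s) := by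
  rw [stepKernel, Kernel.prod_apply, Kernel.id_apply, Measure.dirac_prod]

lemma ae_stepKernel_start (θ : Params n) (s : S) : ∀ᵐ z ∂stepKernel M N θ s, z.1 = s := by
  rw [stepKernel_apply]
  refine (ae_map_iff (by fun_prop) ?_).2 (ae_of_all _ fun _ => rfl)
  exact measurable_fst (measurableSet_singleton s)

lemma ae_stepKernel_of_forall_envKernel (θ : Params n) (s : S) {q : S × M.rewards → Prop}
    (h : ∀ a, ∀ᵐ y ∂envKernel M (s, a), q y) : ∀ᵐ z ∂stepKernel M N θ s, q z.2.2 := by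
  have hq : MeasurableSet {y | q y} := Set.Finite.measurableSet (Set.toFinite _)
  rw [stepKernel_apply]
  refine (ae_map_iff (by fun_prop) ((by fun_prop : Measurable
    fun z : StepRecord M U => z.2.2) hq)).2 ?_
  exact Kernel.ae_compProd_of_ae_ae ((measurable_snd) hq) (ae_of_all _ fun u => h _)

lemma ae_envKernel_of_support (p : S × A) {q : S × M.rewards → Prop}
    (h : ∀ s', M.P p.1 p.2 s' ≠ 0 → ∀ r, M.R p.1 p.2 s' r ≠ 0 → q (s', r)) :
    ∀ᵐ y ∂envKernel M p, q y := by
  have hq : MeasurableSet {y | ¬ q y} := Set.Finite.measurableSet (Set.toFinite _)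
  change ∀ᵐ y ∂((M.P p.1 p.2).bind fun s' => (M.R p.1 p.2 s').map fun r => (s', r)).toMeasure, q y
  rw [ae_iff, PMF.toMeasure_apply_eq_zero_iff _ hq, Set.disjoint_left]
  rintro ⟨s', r⟩ hy
  obtain ⟨s₁, h1, hy⟩ := (PMF.mem_support_bind_iff _ _ _).1 hy
  obtain ⟨r₁, h2, h3⟩ := (PMF.mem_support_map_iff _ _ _).1 hy
  rw [PMF.mem_support_iff] at h1 h2
  simp only [Prod.mk.injEq] at h3
  obtain ⟨rfl, rfl⟩ := h3
  simpa using h s₁ h1 r₁ h2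

/-- The law of the outputs in one time step. -/
lemma map_outputs_stepKernel (θ : Params n) (s : S) :
    (stepKernel M N θ s).map (fun z => z.2.1) = N.outputMeasure θ s := by
  rw [stepKernel_apply, Measure.map_map (by fun_prop) (by fun_prop)]
  have h := Kernel.fst_compProd (N.outputKernel θ)
    ((envKernel M).comap _ (measurable_action_uncurry N))
  have h2 := congrArg (fun k : Kernel S (∀ i, U i) => k s) h
  simp only [Kernel.fst_apply] at h2
  exact h2

lemma integrable_outputMeasure_iff (θ : Params n) (s : S) (φ : (∀ i, U i) → ℝ) :
    Integrable φ (N.outputMeasure θ s)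
      ↔ Integrable (fun u => φ u * N.jointDensity s u θ) (Measure.pi N.ν) := by
  rw [CoagentNetwork.outputMeasure, integrable_withDensity_iff
    (N.measurable_jointDensity s θ).ennreal_ofReal (ae_of_all _ fun _ => ENNReal.ofReal_lt_top)]
  simp_rw [ENNReal.toReal_ofReal (N.jointDensity_nonneg s _ θ)]

lemma integral_outputMeasure (θ : Params n) (s : S) (φ : (∀ i, U i) → ℝ) :
    ∫ u, φ u ∂N.outputMeasure θ s = ∫ u, φ u * N.jointDensity s u θ ∂Measure.pi N.ν := by
  rw [CoagentNetwork.outputMeasure, integral_withDensity_eq_integral_toReal_smul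
    (N.measurable_jointDensity s θ).ennreal_ofReal (ae_of_all _ fun _ => ENNReal.ofReal_lt_top)]
  simp_rw [ENNReal.toReal_ofReal (N.jointDensity_nonneg s _ θ), smul_eq_mul, mul_comm]

/-- The mean of `ψ` over next state and reward, as a function of the outputs; it does not depend on
the parameters. -/
noncomputable def outputMean (ψ : StepRecord M U → ℝ) (s : S) (u : ∀ i, U i) : ℝ :=
  ∫ y, ψ (s, u, y) ∂envKernel M (s, N.action s u)

lemma measurable_outputMean {ψ : StepRecord M U → ℝ} (hψ : Measurable ψ) (s : S) :
    Measurable (outputMean M N ψ s) := by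
  have h1 : StronglyMeasurable fun p : (∀ i, U i) × (S × M.rewards) => ψ (s, p) :=
    (hψ.comp measurable_prodMk_left).stronglyMeasurable
  exact (h1.integral_kernel_prod_right' (κ := (envKernel M).comap (fun u => (s, N.action s u))
    (measurable_const.prodMk (N.action_measurable s)))).measurable

lemma abs_outputMean_le {ψ : StepRecord M U → ℝ} {K : ℝ} (hK : ∀ z, |ψ z| ≤ K) (s : S)
    (u : ∀ i, U i) : |outputMean M N ψ s u| ≤ K := by
  have := norm_integral_le_of_norm_le_const (μ := envKernel M (s, N.action s u))
    (f := fun y => ψ (s, u, y)) (C := K) (ae_of_all _ fun y => hK _)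
  simpa [outputMean] using this

lemma integral_mul_stepKernel (θ : Params n) (s : S) {φ : (∀ i, U i) → ℝ} (hφm : Measurable φ)
    (hφ : Integrable φ (N.outputMeasure θ s)) {ψ : StepRecord M U → ℝ} (hψ : Measurable ψ) {K : ℝ}
    (hK : ∀ z, |ψ z| ≤ K) :
    ∫ z, φ z.2.1 * ψ z ∂stepKernel M N θ s
      = ∫ u, φ u * outputMean M N ψ s u * N.jointDensity s u θ ∂Measure.pi N.ν := by
  have hint : Integrable (fun z : StepRecord M U => φ z.2.1 * ψ z) (stepKernel M N θ s) := by
    refine Integrable.mul_bdd ?_ hψ.aestronglyMeasurable (ae_of_all _ hK)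
    rw [← map_outputs_stepKernel M] at hφ
    exact hφ.comp_measurable (by fun_prop)
  have hm : Measurable fun z : StepRecord M U => φ z.2.1 * ψ z := by fun_prop
  rw [stepKernel_apply] at hint ⊢
  rw [integral_map (by fun_prop) hm.aestronglyMeasurable]
  rw [integrable_map_measure hm.aestronglyMeasurable (by fun_prop)] at hint
  rw [integral_compProd (f := fun x : (∀ i, U i) × (S × M.rewards) => φ x.1 * ψ (s, x)) hint,
    ← integral_outputMeasure]
  simp only [integral_const_mul]
  rfl

lemma integral_stepKernel (θ : Params n) (s : S) {ψ : StepRecord M U → ℝ} (hψ : Measurable ψ)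
    {K : ℝ} (hK : ∀ z, |ψ z| ≤ K) :
    ∫ z, ψ z ∂stepKernel M N θ s
      = ∫ u, outputMean M N ψ s u * N.jointDensity s u θ ∂Measure.pi N.ν := by
  have := integral_mul_stepKernel M N θ s (φ := 1) measurable_const (by
    rw [integrable_outputMeasure_iff]
    simpa using N.integrable_jointDensity s θ) hψ hK
  simpa using this

variable {N}

lemma differentiable_integral_stepKernel (hN : N.DifferentiableInMean)
    {ψ : StepRecord M U → ℝ} (hψ : Measurable ψ) {K : ℝ} (hK : ∀ z, |ψ z| ≤ K) (s : S) :
    Differentiable ℝ fun θ => ∫ z, ψ z ∂stepKernel M N θ s := by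
  simp_rw [integral_stepKernel M N _ s hψ hK]
  intro θ
  obtain ⟨G, hG, -⟩ := CoagentNetwork.hasFDerivAt_integral_mul_jointDensity hN s θ
    (measurable_outputMean M N hψ s) (abs_outputMean_le M N hK s)
  exact hG.differentiableAt

lemma integrable_inner_score (hN : N.DifferentiableInMean) (i : Fin m) (θ : Params n) (s : S)
    (v : EuclideanSpace ℝ (Fin (n i))) :
    Integrable (fun u => (inner ℝ v (N.score i θ s u) : ℝ)) (N.outputMeasure θ s) := by
  rw [integrable_outputMeasure_iff]
  simp_rw [← N.fderiv_jointDensity_coordinateDirection]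
  exact CoagentNetwork.integrable_fderiv_jointDensity_apply hN s θ _

lemma integrable_score (hN : N.DifferentiableInMean) (i : Fin m) (θ : Params n) (s : S) :
    Integrable (fun z : StepRecord M U => N.score i θ z.1 z.2.1) (stepKernel M N θ s) := by
  have h1 : Integrable (fun u => N.score i θ s u) (N.outputMeasure θ s) := by
    have h : ∀ u, N.score i θ s u
        = ∑ j, (inner ℝ (EuclideanSpace.basisFun _ ℝ j) (N.score i θ s u) : ℝ) •
          EuclideanSpace.basisFun (Fin (n i)) ℝ j := fun u =>
      ((EuclideanSpace.basisFun (Fin (n i)) ℝ).sum_repr' _).symm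
    rw [funext h]
    exact integrable_finsetSum _ fun j _ => (integrable_inner_score hN i θ s _).smul_const _
  rw [← map_outputs_stepKernel M] at h1
  refine (h1.comp_measurable (by fun_prop)).congr ?_
  filter_upwards [ae_stepKernel_start M N θ s] with z hz
  simp [hz]

/-- Derivatives of expectations over one time step are expectations against the score. -/
lemma fderiv_integral_stepKernel (hN : N.DifferentiableInMean)
    {ψ : StepRecord M U → ℝ} (hψ : Measurable ψ) {K : ℝ} (hK : ∀ z, |ψ z| ≤ K) (s : S)
    (θ : Params n) (i : Fin m) (v : EuclideanSpace ℝ (Fin (n i))) :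
    fderiv ℝ (fun θ => ∫ z, ψ z ∂stepKernel M N θ s) θ (CoagentNetwork.coordinateDirection i v)
      = ∫ z, inner ℝ v (N.score i θ z.1 z.2.1) * ψ z ∂stepKernel M N θ s := by
  simp_rw [integral_stepKernel M N _ s hψ hK]
  obtain ⟨G, hG, hG'⟩ := CoagentNetwork.hasFDerivAt_integral_mul_jointDensity hN s θ
    (measurable_outputMean M N hψ s) (abs_outputMean_le M N hK s)
  rw [hG.fderiv, hG']
  have h1 : ∫ z, inner ℝ v (N.score i θ z.1 z.2.1) * ψ z ∂stepKernel M N θ s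
      = ∫ z, inner ℝ v (N.score i θ s z.2.1) * ψ z ∂stepKernel M N θ s := by
    refine integral_congr_ae ?_
    filter_upwards [ae_stepKernel_start M N θ s] with z hz
    rw [hz]
  have hm : Measurable fun u => (inner ℝ v (N.score i θ s u) : ℝ) :=
    measurable_const.inner ((N.measurable_score i θ).comp measurable_prodMk_left)
  rw [h1, integral_mul_stepKernel M N θ s hm (integrable_inner_score hN i θ s v) hψ hK]
  congr 1
  ext u
  rw [N.fderiv_jointDensity_coordinateDirection]
  ring

end Step

/-! ### The policy gradient theorem -/

section PolicyGradient

variable {S A : Type*} [MeasurableSpace S] [MeasurableSpace A] {m : ℕ}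
  {U : Fin m → Type*} [∀ i, MeasurableSpace (U i)] {n : Fin m → ℕ}
  [Fintype S] [MeasurableSingletonClass S] [Finite A] [MeasurableSingletonClass A]
  {M : MDP S A} {N : CoagentNetwork S A U n}

/-- Finite returns mean that the process is absorbed summably, in the empty set if the discount
factor is below one and in the terminal states otherwise, and that rewards vanish there. -/
lemma HasFiniteReturns.exists_isSummablyAbsorbed (hM : HasFiniteReturns M N) :
    ∃ Z : Set S,
      (∀ θ, ∃ a, IsSummablyAbsorbed (stepKernel M N θ) nextState M.γ Z a) ∧
      ∀ θ, ∀ s ∈ Z, ∀ᵐ z ∂stepKernel M N θ s, stepReward z = 0 := by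
  by_cases hγ : M.γ < 1
  · exact ⟨∅, fun θ => ⟨_, isSummablyAbsorbed_of_lt_one (measurable_nextState M) M.γ_nonneg hγ⟩,
      by simp⟩
  · obtain ⟨⟨Z, hZ, hreach⟩, -⟩ := hM.resolve_left hγ
    have hγ1 : M.γ = 1 := le_antisymm M.γ_le_one (not_lt.1 hγ)
    refine ⟨Z, fun θ => ?_, fun θ s hs => ?_⟩
    · rw [hγ1]
      refine ⟨_, isSummablyAbsorbed_of_ae_reaches (measurable_nextState M)
        (st := fun z : StepRecord M U => z.1) (by fun_prop) (ae_stepKernel_start M N θ)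
        (fun s hs => ?_) fun s => ?_⟩
      · exact ae_stepKernel_of_forall_envKernel M N θ s (q := fun y => y.1 ∈ Z) fun a =>
          ae_envKernel_of_support M (s, a) fun s' h _ _ => (hZ s hs a s' h).1
      · have := hreach θ s
        rw [episode_eq_chainMeasure, PMF.toMeasure_pure] at this
        exact this
    · exact ae_stepKernel_of_forall_envKernel M N θ s (q := fun y => (y.2 : ℝ) = 0) fun a =>
        ae_envKernel_of_support M (s, a) fun s' h r hr => (hZ s hs a s' h).2 r hr

/-- The value function of the network, in the form that is differentiated. -/
noncomputable def valueFunction (M : MDP S A) (N : CoagentNetwork S A U n) (θ : Params n) : S → ℝ :=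
  potential (stepKernel M N θ) nextState M.γ fun s => ∫ z, stepReward z ∂stepKernel M N θ s

lemma objective_eq_expectation_valueFunction (hM : HasFiniteReturns M N) :
    objective M N = fun θ => expectationCLM M.d₀.toMeasure (valueFunction M N θ) := by
  obtain ⟨Z, hZ, hZr⟩ := hM.exists_isSummablyAbsorbed
  obtain ⟨K, hK0, hK⟩ := exists_abs_stepReward_le (U := U) M
  ext θ
  obtain ⟨a, ha⟩ := hZ θ
  have h := ha.integral_tsum_reward (measurable_nextState M) M.d₀.toMeasure
    (measurable_stepReward M) hK0 hK (hZr θ)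
  rw [← episode_eq_chainMeasure] at h
  rw [expectationCLM_apply, valueFunction, ← h, objective]
  simp only [discountedReturn, zero_add]
  rfl

/-- With a discount factor below one, the objective is bounded because rewards are. -/
lemma HasFiniteReturns.bddAbove_objective (hM : HasFiniteReturns M N) :
    BddAbove (Set.range (objective M N)) := by
  by_cases hγ : M.γ < 1
  swap
  · exact (hM.resolve_left hγ).2
  obtain ⟨K, hK0, hK⟩ := exists_abs_stepReward_le (U := U) M
  refine ⟨K * ∑' k, M.γ ^ k, ?_⟩
  rintro _ ⟨θ, rfl⟩
  have ha := isSummablyAbsorbed_of_lt_one (κ := stepKernel M N θ) (measurable_nextState M)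
    M.γ_nonneg hγ
  have hdom := IsSummablyAbsorbed.abs_integral_reward_le (κ := stepKernel M N θ) (Z := ∅)
    hK0 hK (by simp)
  rw [objective_eq_expectation_valueFunction hM]
  refine (le_abs_self _).trans (abs_expectationCLM_le _ fun s => ?_)
  simpa [valueFunction] using ha.abs_potential_le (measurable_nextState M) hK0 hdom s

lemma differentiable_valueFunction (hN : N.DifferentiableInMean) (hM : HasFiniteReturns M N) :
    Differentiable ℝ (valueFunction M N) := by
  obtain ⟨Z, hZ, hZr⟩ := hM.exists_isSummablyAbsorbed
  obtain ⟨K, hK0, hK⟩ := exists_abs_stepReward_le (U := U) M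
  exact differentiable_potential (measurable_nextState M)
    (fun ψ hψ ⟨K, hK⟩ s => differentiable_integral_stepKernel M hN hψ hK s) hZ
    (measurable_stepReward M) hK0 hK hZr

theorem differentiable_objective (hN : N.DifferentiableInMean) (hM : HasFiniteReturns M N) :
    Differentiable ℝ (objective M N) := by
  rw [objective_eq_expectation_valueFunction hM]
  exact (expectationCLM M.d₀.toMeasure).differentiable.comp (differentiable_valueFunction hN hM)

/-- Almost surely, all outputs of an episode have positive density, so that gradients of logarithms
are scores. -/
lemma localPolicyGradient_eq_integral_score (i : Fin m) (θ : Params n) :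
    localPolicyGradient M N i θ
      = ∫ ω, ∑' t, (M.γ ^ t * ∑' k, M.γ ^ k * stepReward (ω (t + k))) •
          N.score i θ (ω t).1 (ω t).2.1 ∂episode M N θ M.d₀ := by
  have hm : MeasurableSet {z : StepRecord M U | N.jointDensity z.1 z.2.1 θ ≠ 0} := by
    have h : Measurable fun z : StepRecord M U => N.jointDensity z.1 z.2.1 θ := by
      have h1 : Measurable fun p : S × (∀ i, U i) => N.jointDensity p.1 p.2 θ :=
        measurable_from_prod_countable_right fun s => N.measurable_jointDensity s θ
      exact h1.comp (g := fun p : S × (∀ i, U i) => N.jointDensity p.1 p.2 θ)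
        (f := fun z : StepRecord M U => (z.1, z.2.1)) (by fun_prop)
    exact (h (measurableSet_singleton 0)).compl
  have hstep : ∀ s, ∀ᵐ z ∂stepKernel M N θ s, N.jointDensity z.1 z.2.1 θ ≠ 0 := by
    intro s
    have h1 : ∀ᵐ u ∂N.outputMeasure θ s, N.jointDensity s u θ ≠ 0 := by
      rw [CoagentNetwork.outputMeasure,
        ae_withDensity_iff (N.measurable_jointDensity s θ).ennreal_ofReal]
      refine ae_of_all _ fun u hu h0 => hu ?_
      rw [h0, ENNReal.ofReal_zero]
    rw [← map_outputs_stepKernel M] at h1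
    filter_upwards [ae_of_ae_map (by fun_prop) h1, ae_stepKernel_start M N θ s] with z hz hz'
    rw [hz']
    exact hz
  rw [localPolicyGradient]
  refine integral_congr_ae ?_
  have h2 := ae_chainMeasure_of_forall (measurable_nextState M) M.d₀.toMeasure hm hstep
  rw [← episode_eq_chainMeasure] at h2
  filter_upwards [h2] with ω hω
  refine tsum_congr fun t => ?_
  rw [stateAt, outputsAt, N.gradient_log_policy i θ _ _ (hω t)]
  rfl

/-- The policy gradient theorem for coagent networks: the local policy gradients are the components
of the gradient of the objective. -/
theorem gradient_objective (hN : N.DifferentiableInMean) (hM : HasFiniteReturns M N)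
    (θ : Params n) :
    gradient (objective M N) θ = WithLp.toLp 2 fun i => localPolicyGradient M N i θ := by
  obtain ⟨Z, hZ, hZr⟩ := hM.exists_isSummablyAbsorbed
  obtain ⟨K, hK0, hK⟩ := exists_abs_stepReward_le (U := U) M
  obtain ⟨a, ha⟩ := hZ θ
  have hn := measurable_nextState (U := U) M
  have key : ∀ i, ∀ v : EuclideanSpace ℝ (Fin (n i)),
      fderiv ℝ (objective M N) θ (CoagentNetwork.coordinateDirection i v)
        = inner ℝ v (localPolicyGradient M N i θ) := by
    intro i v
    have hsm : Measurable fun z : StepRecord M U => N.score i θ z.1 z.2.1 :=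
      (N.measurable_score i θ).comp (g := fun p : S × (∀ i, U i) => N.score i θ p.1 p.2)
        (f := fun z : StepRecord M U => (z.1, z.2.1)) (by fun_prop)
    have hsi := integrable_score M hN i θ
    have h1 := ha.inner_integral_tsum_return_smul hn M.d₀.toMeasure (measurable_stepReward M)
      hK0 hK (hZr θ) hsm.stronglyMeasurable hsi v
    rw [← episode_eq_chainMeasure, ← localPolicyGradient_eq_integral_score] at h1
    have h2 := fderiv_potential_apply (κ := stepKernel M N) (θ := θ)
      (w := CoagentNetwork.coordinateDirection i v) hn
      (fun ψ hψ ⟨K, hK⟩ s => differentiable_integral_stepKernel M hN hψ hK s) hZ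
      (measurable_stepReward M) hK0 hK hZr (fun s => (hsi s).const_inner v)
      (fun ψ hψ ⟨K, hK⟩ s => fderiv_integral_stepKernel M hN hψ hK s θ i v)
    have h3 : HasFDerivAt (objective M N) ((expectationCLM M.d₀.toMeasure).comp
        (fderiv ℝ (valueFunction M N) θ)) θ := by
      rw [objective_eq_expectation_valueFunction hM]
      exact (expectationCLM M.d₀.toMeasure).hasFDerivAt.comp θ
        (differentiable_valueFunction hN hM θ).hasFDerivAt
    rw [h1, h3.fderiv, ContinuousLinearMap.comp_apply, expectationCLM_apply]
    exact congrArg (fun g : S → ℝ => ∫ s, g s ∂M.d₀.toMeasure) h2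
  ext1 i
  refine ext_inner_left ℝ fun v => ?_
  rw [← key i v, ← InnerProductSpace.toDual_symm_apply (𝕜 := ℝ), ← gradient, real_inner_comm _
    (gradient (objective M N) θ), CoagentNetwork.inner_coordinateDirection]

end PolicyGradient

/-! ### Convergence of coagent networks -/

theorem corollary1
    {S A : Type*} [Finite S] [MeasurableSpace S] [MeasurableSingletonClass S]
    [Finite A] [MeasurableSpace A] [MeasurableSingletonClass A]
    {m : ℕ} {U : Fin m → Type*} [∀ i, MeasurableSpace (U i)] {n : Fin m → ℕ}
    (M : MDP S A) (N : CoagentNetwork S A U n)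
    (hN : N.DifferentiableInMean) (hM : HasFiniteReturns M N)
    -- technical condition on the objective: its gradient is Lipschitz continuous
    (L : ℝ≥0) (hJ : LipschitzWith L (gradient (objective M N)))
    -- the step sizes
    (α : ℕ → ℝ) (hα_pos : ∀ t, 0 < α t)
    (hα_sum : Tendsto (fun T => ∑ t ∈ Finset.range T, α t) atTop atTop)
    (hα_sq : Summable fun t => α t ^ 2)
    -- the random parameters `θ t` and the estimates `D t` after `t` updates
    {Ω : Type*} [mΩ : MeasurableSpace Ω] (μ : Measure Ω) [IsProbabilityMeasure μ]
    (ℱ : Filtration ℕ mΩ) (θ D : ℕ → Ω → Params n)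
    (hθ : StronglyAdapted ℱ θ)
    (h_update : ∀ t ω i, θ (t + 1) ω i = θ t ω i + α t • D t ω i)
    -- every estimate is an unbiased estimate of the local policy gradient
    (hD_int : ∀ t, Integrable (D t) μ)
    (hD_unbiased : ∀ t i, μ[fun ω => D t ω i | ℱ t]
      =ᵐ[μ] fun ω => localPolicyGradient M N i (θ t ω))
    -- technical condition on the noise: growth of its conditional second moment
    (C : ℝ≥0)
    (hD_noise : ∀ t, condLExp (ℱ t) μ
        (fun ω => ‖D t ω - WithLp.toLp 2 fun i => localPolicyGradient M N i (θ t ω)‖ₑ ^ 2)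
      ≤ᵐ[μ] fun ω => C * (1 + ‖gradient (objective M N) (θ t ω)‖ₑ ^ 2)) :
    Differentiable ℝ (objective M N) ∧
      ∀ᵐ ω ∂μ, (∃ J : ℝ, Tendsto (fun t => objective M N (θ t ω)) atTop (𝓝 J)) ∧
        Tendsto (fun t => gradient (objective M N) (θ t ω)) atTop (𝓝 0) := by
  have : Fintype S := Fintype.ofFinite S
  have hgrad := gradient_objective hN hM
  refine ⟨differentiable_objective hN hM, ?_⟩
  refine ae_tendsto_of_stochastic_gradient_ascent (differentiable_objective hN hM) hJ
    hM.bddAbove_objective hα_pos hα_sum hα_sq hθ (fun t ω => ?_) hD_int (fun t => ?_)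
    (C := C) (fun t => ?_)
  · ext1 i
    exact h_update t ω i
  · -- conditional expectations are computed componentwise
    have hcomp : ∀ i, ∀ᵐ ω ∂μ, (μ[D t | ℱ t]) ω i = localPolicyGradient M N i (θ t ω) := by
      intro i
      have h := (PiLp.proj (𝕜 := ℝ) 2
        (fun i : Fin m => EuclideanSpace ℝ (Fin (n i))) i).comp_condExp_comm (m := ℱ t) (hD_int t)
      filter_upwards [h, hD_unbiased t i] with ω h1 h2
      exact h1.trans h2
    filter_upwards [ae_all_iff.2 hcomp] with ω hω
    rw [hgrad]
    ext1 i
    exact hω i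
  · simp_rw [← hgrad] at hD_noise
    exact hD_noise t
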